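/- Write $\mathcal R_a=[0,a]\times[0,1]\subset\mathbb C$. For $R>T>0$, a conformal embedding of $\mathcal R_R$ into $\mathcal R_T$ is a homeomorphism $E$ of $\mathcal R_R$ onto a closed Jordan domain $E(\mathcal R_R)\subset\mathcal R_T$ (the shape), conformal in the interior, which maps the vertices $0,R,R+i,i$ to quad-vertices $0,p_1,p_2,i$ with $p_1,p_2\in\{T\}\times[0,1]$ and $\operatorname{Im}p_1<\operatorname{Im}p_2$, the left side $[0,i]$ onto $[0,i]$ and the right side $[R,R+i]$ onto the segment $[p_1,p_2]$. If $[0,1]^2\subset E(\mathcal R_R)$ and $\varepsilon>0$, the shape is called $\varepsilon$-admissible if there is a homeomorphism $\alpha$ of $E(\mathcal R_R)$ onto itself that is $K$-quasiconformal in the interior for some $K<1+\varepsilon$, fixes the four quad-vertices $0,p_1,p_2,i$, and satisfies $\alpha(E(z))=z$ for all $z\in[0,1]^2$. Here $K$-quasiconformal ($K\ge1$) means: an orientation-preserving homeomorphism with locally integrable distributional derivatives $\alpha_z,\alpha_{\bar z}$ such that $|\alpha_{\bar z}|\le\frac{K-1}{K+1}|\alpha_z|$ almost everywhere; its dilatation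 is $\mu_\alpha=\alpha_{\bar z}/\alpha_z$. Proposition. There is an absolute constant $C>0$ such that the following holds. Let $T\ge 6$, let $M\ge2$ be a natural number with $2M<T$, let $R>T$, and let $E$ be a conformal embedding of $\mathcal R_R$ into $\mathcal R_T$ whose shape contains $[0,2M]\times[0,1]$. Then the shape $E(\mathcal R_R)$ is $\varepsilon$-admissible with $$\varepsilon=C\,\frac{e^{-\pi(M-1)/2}}{M},$$ and the map $\alpha$ can moreover be chosen so that its dilatation $\mu_\alpha$ vanishes almost everywhere outside $[0,M]\times[0,1]$. -/

import Mathlib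

open Set MeasureTheory
open scoped ContDiff

noncomputable section

namespace AdmissibleShapes

/-- The closed rectangle `[0,a] × [0,1]`. -/
def rect (a : ℝ) : Set ℂ := {z | z.re ∈ Icc 0 a ∧ z.im ∈ Icc (0 : ℝ) 1}

/-- The open rectangle `(0,a) × (0,1)`. -/
def openRect (a : ℝ) : Set ℂ := {z | z.re ∈ Ioo 0 a ∧ z.im ∈ Ioo (0 : ℝ) 1}

/-- The vertical segment `{x} × [0,1]`. -/
def vertSide (x : ℝ) : Set ℂ := {z | z.re = x ∧ z.im ∈ Icc (0 : ℝ) 1}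

/-! ### Quasiconformal maps (analytic definition) -/

/-- The Wirtinger derivative `∂φ = (φ_x - i φ_y) / 2` of a real-differentiable function. -/
def wirtinger (φ : ℂ → ℂ) (z : ℂ) : ℂ :=
  (fderiv ℝ φ z 1 - Complex.I * fderiv ℝ φ z Complex.I) / 2

/-- The Wirtinger derivative `∂̄φ = (φ_x + i φ_y) / 2` of a real-differentiable function. -/
def wirtingerBar (φ : ℂ → ℂ) (z : ℂ) : ℂ :=
  (fderiv ℝ φ z 1 + Complex.I * fderiv ℝ φ z Complex.I) / 2

/-- `p` and `q` are locally integrable and are the distributional derivatives `f_z` and `f_z̄`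
of `f` on the open set `Ω`. -/
structure IsWeakWirtinger (f : ℂ → ℂ) (Ω : Set ℂ) (p q : ℂ → ℂ) : Prop where
  locInt_p : LocallyIntegrableOn p Ω
  locInt_q : LocallyIntegrableOn q Ω
  weak_p : ∀ φ : ℂ → ℂ, ContDiff ℝ ∞ φ → HasCompactSupport φ → tsupport φ ⊆ Ω →
    ∫ z, f z * wirtinger φ z = -∫ z, p z * φ z
  weak_q : ∀ φ : ℂ → ℂ, ContDiff ℝ ∞ φ → HasCompactSupport φ → tsupport φ ⊆ Ω →
    ∫ z, f z * wirtingerBar φ z = -∫ z, q z * φ z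

/-- `f` has local degree one in `Ω`: as `w` runs once counterclockwise around a circle bounding
a closed disc in `Ω` with centre `z`, the argument of `f w - f z` increases by `2π`. -/
def OrientationPreservingOn (f : ℂ → ℂ) (Ω : Set ℂ) : Prop :=
  ∀ z ∈ Ω, ∀ r : ℝ, 0 < r → Metric.closedBall z r ⊆ Ω →
    ∃ θ : ℝ → ℝ, Continuous θ ∧
      (∀ t : ℝ, f (circleMap z r t) - f z =
        (‖f (circleMap z r t) - f z‖ : ℂ) * Complex.exp (θ t * Complex.I)) ∧
      θ (2 * Real.pi) = θ 0 + 2 * Real.pi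

/-- `f` restricts to a `K`-quasiconformal map of the open set `Ω` onto the open set `Ω'`. -/
structure IsQuasiconformal (K : ℝ) (f : ℂ → ℂ) (Ω Ω' : Set ℂ) : Prop where
  one_le : 1 ≤ K
  homeo : ∃ e : OpenPartialHomeomorph ℂ ℂ, e.source = Ω ∧ e.target = Ω' ∧ EqOn f e Ω
  orientation : OrientationPreservingOn f Ω
  beltrami : ∃ p q : ℂ → ℂ, IsWeakWirtinger f Ω p q ∧
    ∀ᵐ z ∂volume.restrict Ω, ‖q z‖ ≤ (K - 1) / (K + 1) * ‖p z‖

/-- `μ` is the dilatation (Beltrami coefficient) `f_z̄ / f_z` of `f` on `Ω`. -/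
def IsDilatation (f : ℂ → ℂ) (Ω : Set ℂ) (μ : ℂ → ℂ) : Prop :=
  ∃ p q : ℂ → ℂ, IsWeakWirtinger f Ω p q ∧ ∀ᵐ z ∂volume.restrict Ω, μ z = q z / p z

/-- The dilatation of `f` on `Ω` vanishes almost everywhere outside `A`. -/
def DilatationSupportedIn (f : ℂ → ℂ) (Ω A : Set ℂ) : Prop :=
  ∃ μ : ℂ → ℂ, IsDilatation f Ω μ ∧ ∀ᵐ z ∂volume.restrict Ω, z ∉ A → μ z = 0

/-! ### Shapes -/

/-- `E` is a conformal embedding of `[0,R] × [0,1]` into `[0,T] × [0,1]`, where `T < R`: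
a homeomorphism of the closed rectangle onto a closed Jordan domain in `[0,T] × [0,1]`,
conformal inside, sending the vertices `0, R, R + i, i` to the quad-vertices `0, p₁, p₂, i`, where
`p₁, p₂ ∈ {T} × [0,1]` and `Im p₁ < Im p₂`, the left side to `[0,i]` and the right side to
`[p₁,p₂]`. The two remaining sides `γ₁, γ₂` of the quadrilateral are the images of the
horizontal sides. The shape is `E '' rect R`. -/
structure IsConformalEmbedding (R T : ℝ) (E : ℂ → ℂ) : Prop where
  pos : 0 < T
  lt : T < R
  continuousOn : ContinuousOn E (rect R)
  injOn : InjOn E (rect R)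
  holo : DifferentiableOn ℂ E (openRect R)
  mapsTo : MapsTo E (rect R) (rect T)
  map_zero : E 0 = 0
  map_I : E Complex.I = Complex.I
  re_p₁ : (E R).re = T
  re_p₂ : (E (R + Complex.I)).re = T
  im_lt : (E R).im < (E (R + Complex.I)).im
  left_side : E '' vertSide 0 = vertSide 0
  right_side : E '' vertSide R = segment ℝ (E R) (E (R + Complex.I))

/-- `α` is a map that exhibits the shape `E '' rect R` as `ε`-admissible: a self-homeomorphism of
the closed shape, quasiconformal inside with maximal dilatation less than `1 + ε`, that fixes the
four quad-vertices and for which `α ∘ E` is the identity on `[0,1]²`. -/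
structure IsAdmissibleMap (ε R T : ℝ) (E α : ℂ → ℂ) : Prop where
  embedding : IsConformalEmbedding R T E
  square_subset : rect 1 ⊆ E '' rect R
  continuousOn : ContinuousOn α (E '' rect R)
  bijOn : BijOn α (E '' rect R) (E '' rect R)
  fix_vertices : ∀ v ∈ ({0, (R : ℂ), (R : ℂ) + Complex.I, Complex.I} : Set ℂ), α (E v) = E v
  comp_eq_id : EqOn (α ∘ E) id (rect 1)
  quasiconformal : ∃ K : ℝ, K < 1 + ε ∧
    IsQuasiconformal K α (E '' openRect R) (E '' openRect R)

end AdmissibleShapes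

end

/-!
On `[0, L] × [0, 1]` the function `E⁻¹ - id` is holomorphic, real on the horizontal sides and
imaginary on the left side, and its imaginary part is at most `1` in absolute value. By reflection
it has an expansion `∑ aₙ sinh (π (n + 1) z)`, and reading off the coefficients on the vertical
segment `Re z = L` gives `|aₙ| ≤ 4 exp (-π (n + 1) L)`. Hence it is `O(exp (-π L))` on
`[0, 2] × [0, 1]`, together with its derivative. Multiplied by a cutoff function of `Re z`, it
becomes a perturbation `g` of small Lipschitz constant, and `α z = z + g z` is a quasiconformal
homeomorphism that preserves the sides of the half-strip, is the identity for `2 ≤ Re z`, and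
equals `E⁻¹` on the image of the unit square.
-/

noncomputable section

namespace AdmissibleShapes

open Complex Topology Filter ComplexConjugate

/-! ### Continuous injections of compact convex sets into the plane -/

lemma continuousOn_invFunOn_image {X Y : Type*} [TopologicalSpace X] [Nonempty X]
    [TopologicalSpace Y] [T2Space Y] {K : Set X} {f : X → Y} (hK : IsCompact K)
    (hf : ContinuousOn f K) (hinj : InjOn f K) :
    ContinuousOn (Function.invFunOn f K) (f '' K) := by
  rw [continuousOn_iff_isClosed]
  intro t ht
  refine ⟨f '' (K ∩ t), ((hK.inter_right ht).image_of_continuousOn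
    (hf.mono inter_subset_left)).isClosed, ?_⟩
  ext w
  constructor
  · rintro ⟨hw, z, hz, rfl⟩
    rw [mem_preimage, hinj.leftInvOn_invFunOn hz] at hw
    exact ⟨⟨z, ⟨hz, hw⟩, rfl⟩, z, hz, rfl⟩
  · rintro ⟨⟨z, ⟨hz, hw⟩, rfl⟩, -⟩
    exact ⟨by rwa [mem_preimage, hinj.leftInvOn_invFunOn hz], z, hz, rfl⟩

lemma not_exists_continuous_log_circle (c : ℂ) :
    ¬ ∃ ℓ : Circle → ℂ, Continuous ℓ ∧ ∀ u : Circle, exp (ℓ u) = c * u := by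
  rintro ⟨ℓ, hℓ, hexp⟩
  have lift_eq : (fun t : ℝ => ℓ (Circle.exp t)) = fun t : ℝ => t * I + ℓ 1 := by
    refine isCoveringMap_exp.eq_of_comp_eq (by fun_prop) (by fun_prop) ?_ 0 (by simp)
    funext t
    apply Subtype.ext
    simp [hexp, exp_add, mul_comm]
  simpa [Real.pi_ne_zero] using congrFun lift_eq (2 * Real.pi)

lemma exists_continuous_log_of_homotopy {X : Type*} [TopologicalSpace X]
    (H : C(unitInterval × X, {z : ℂ // z ≠ 0})) {w : {z : ℂ // z ≠ 0}}
    (hw : ∀ x, H (0, x) = w) :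
    ∃ ℓ : X → ℂ, Continuous ℓ ∧ ∀ x, exp (ℓ x) = H (1, x) := by
  have start : ∀ x, H (0, x) = ⟨exp (ContinuousMap.const X (log w) x), exp_ne_zero _⟩ :=
    fun x => Subtype.ext (by simp [hw, exp_log w.2])
  refine ⟨fun x => isCoveringMap_exp.liftHomotopy H (.const _ (log w)) start (1, x),
    by fun_prop, fun x => ?_⟩
  exact congrArg Subtype.val (congrFun (isCoveringMap_exp.liftHomotopy_lifts H _ start) (1, x))

section ConvexCompact

variable {V : Type*} [AddCommGroup V] [Module ℝ V] [TopologicalSpace V] [IsTopologicalAddGroup V]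
  [ContinuousSMul ℝ V] {K : Set V} {f : V → ℂ} {ζ c : V}

/-- Otherwise a small circle around `f ζ` could be contracted in `f '' K` without meeting `f ζ`. -/
lemma image_notMem_nhds_of_starConvex_diff_singleton (hK : IsCompact K) (hf : ContinuousOn f K)
    (hinj : InjOn f K) (hζ : ζ ∈ K) (hc : c ∈ K \ {ζ}) (hstar : StarConvex ℝ c (K \ {ζ})) :
    f '' K ∉ 𝓝 (f ζ) := by
  intro hnhds
  obtain ⟨r, hr, hball⟩ := Metric.nhds_basis_closedBall.mem_iff.mp hnhds
  set F := Function.invFunOn f K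
  have right_inv : ∀ w ∈ f '' K, f (F w) = w := (surjOn_image f K).rightInvOn_invFunOn
  set circle : Circle → ℂ := fun u => f ζ + r * u
  have circle_mem : ∀ u, circle u ∈ f '' K := fun u =>
    hball (by simp [circle, abs_of_pos hr, Circle.norm_coe])
  have lift_continuous : Continuous fun u => F (circle u) :=
    (continuousOn_invFunOn_image hK hf hinj).comp_continuous (by fun_prop) circle_mem
  have lift_mem : ∀ u, F (circle u) ∈ K \ {ζ} := fun u => by
    refine ⟨(surjOn_image f K).mapsTo_invFunOn (circle_mem u), fun hu => ?_⟩
    simpa [mem_singleton_iff.mp hu, circle, hr.ne'] using right_inv _ (circle_mem u)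
  set contraction : unitInterval × Circle → V := fun x => c + (x.1 : ℝ) • (F (circle x.2) - c)
  have contraction_mem : ∀ x, contraction x ∈ K \ {ζ} := fun x =>
    hstar.add_smul_sub_mem (lift_mem x.2) x.1.2.1 x.1.2.2
  have contraction_continuous : Continuous contraction :=
    continuous_const.add ((continuous_subtype_val.comp continuous_fst).smul
      ((lift_continuous.comp continuous_snd).sub continuous_const))
  let H : C(unitInterval × Circle, {z : ℂ // z ≠ 0}) :=
    ⟨fun x => ⟨f (contraction x) - f ζ, fun h =>
      (contraction_mem x).2 (hinj (contraction_mem x).1 hζ (sub_eq_zero.mp h))⟩,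
      ((hf.comp_continuous contraction_continuous fun x => (contraction_mem x).1).sub
        continuous_const).subtype_mk _⟩
  obtain ⟨ℓ, hℓ, hexp⟩ := exists_continuous_log_of_homotopy H
    (w := ⟨f c - f ζ, fun h => hc.2 (hinj hc.1 hζ (sub_eq_zero.mp h))⟩)
    fun u => Subtype.ext (by simp [H, contraction])
  refine not_exists_continuous_log_circle r ⟨ℓ, hℓ, fun u => ?_⟩
  simp [hexp, H, contraction, right_inv _ (circle_mem u), circle]

lemma image_notMem_nhds_of_notMem_interior (hK : IsCompact K) (hconv : Convex ℝ K)
    (hne : (interior K).Nonempty) (hf : ContinuousOn f K) (hinj : InjOn f K) (hζ : ζ ∈ K)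
    (hζ' : ζ ∉ interior K) : f '' K ∉ 𝓝 (f ζ) := by
  obtain ⟨c, hc⟩ := hne
  refine image_notMem_nhds_of_starConvex_diff_singleton hK hf hinj hζ
    ⟨interior_subset hc, fun h => hζ' (h ▸ hc)⟩ ?_
  rintro y ⟨hy, hyζ⟩ a b ha hb hab
  rcases ha.eq_or_lt with rfl | ha
  · simpa [(zero_add b).symm.trans hab] using ⟨hy, hyζ⟩
  · have mem_interior := hconv.combo_interior_self_mem_interior hc hy ha hb hab
    exact ⟨interior_subset mem_interior, fun h => hζ' (h ▸ mem_interior)⟩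

end ConvexCompact

/-! ### Inverses of holomorphic functions -/

lemma isOpen_image_of_injOn {U : Set ℂ} {f : ℂ → ℂ} (hU : IsOpen U)
    (hf : DifferentiableOn ℂ f U) (hinj : InjOn f U) : IsOpen (f '' U) := by
  rw [isOpen_iff_mem_nhds]
  rintro _ ⟨z, hz, rfl⟩
  rcases (hf.analyticAt (hU.mem_nhds hz)).eventually_constant_or_nhds_le_map_nhds with hconst | h
  · have eventually_eq : ∀ᶠ w in 𝓝[≠] z, w = z := by
      filter_upwards [mem_nhdsWithin_of_mem_nhds hconst,
        mem_nhdsWithin_of_mem_nhds (hU.mem_nhds hz)] with w hw hwU using hinj hwU hz hw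
    obtain ⟨w, hw, hne⟩ := (eventually_eq.and self_mem_nhdsWithin).exists
    exact absurd hw hne
  · exact h (image_mem_map (hU.mem_nhds hz))

lemma eventually_eq_of_eventually_deriv_eq_zero {f : ℂ → ℂ} {z : ℂ} (hf : AnalyticAt ℂ f z)
    (hderiv : ∀ᶠ w in 𝓝 z, deriv f w = 0) : ∀ᶠ w in 𝓝 z, f w = f z := by
  obtain ⟨r, hr, hball⟩ := Metric.mem_nhds_iff.mp (hf.eventually_analyticAt.and hderiv)
  filter_upwards [Metric.ball_mem_nhds z hr] with w hw
  exact Metric.isOpen_ball.is_const_of_deriv_eq_zero (convex_ball z r).isPreconnected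
    (fun x hx => (hball hx).1.differentiableAt.differentiableWithinAt)
    (fun x hx => (hball hx).2) hw (Metric.mem_ball_self hr)

lemma differentiableOn_of_continuousOn_rightInvOn {U V : Set ℂ} {f g : ℂ → ℂ} (hU : IsOpen U)
    (hV : IsOpen V) (hf : DifferentiableOn ℂ f U) (hg : ContinuousOn g V) (hmaps : MapsTo g V U)
    (hfg : RightInvOn g f V) : DifferentiableOn ℂ g V := by
  intro w hw
  have hgw : Tendsto g (𝓝 w) (𝓝 (g w)) := hg.continuousAt (hV.mem_nhds hw)
  have hgw' : Tendsto g (𝓝[≠] w) (𝓝[≠] (g w)) := by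
    refine tendsto_nhdsWithin_iff.mpr ⟨hgw.mono_left nhdsWithin_le_nhds, ?_⟩
    filter_upwards [self_mem_nhdsWithin, mem_nhdsWithin_of_mem_nhds (hV.mem_nhds hw)] with v hv hvV
    exact fun h => hv (hfg.injOn hvV hw h)
  have hfan : AnalyticAt ℂ f (g w) := hf.analyticAt (hU.mem_nhds (hmaps hw))
  refine (analyticAt_of_differentiable_on_punctured_nhds_of_continuousAt ?_
    hgw).differentiableAt.differentiableWithinAt
  rcases hfan.deriv.eventually_eq_zero_or_eventually_ne_zero with hzero | hne
  · have hconst := hgw'.eventually (mem_nhdsWithin_of_mem_nhds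
      (eventually_eq_of_eventually_deriv_eq_zero hfan hzero))
    obtain ⟨v, ⟨hv, hvV⟩, hne⟩ := ((hconst.and (mem_nhdsWithin_of_mem_nhds
      (hV.mem_nhds hw))).and self_mem_nhdsWithin).exists
    exact absurd ((hfg hvV).symm.trans (hv.trans (hfg hw))) hne
  · filter_upwards [hgw'.eventually hne, mem_nhdsWithin_of_mem_nhds (hV.mem_nhds hw)] with v hv hvV
    refine (HasDerivAt.of_local_left_inverse (hg.continuousAt (hV.mem_nhds hvV))
      (hf.differentiableAt (hU.mem_nhds (hmaps hvV))).hasDerivAt hv ?_).differentiableAt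
    filter_upwards [hV.mem_nhds hvV] with y hy using hfg hy

/-! ### Conformal embeddings of rectangles -/

lemma rect_eq_reProdIm (a : ℝ) : rect a = Icc 0 a ×ℂ Icc 0 1 := rfl

lemma openRect_eq_reProdIm (a : ℝ) : openRect a = Ioo 0 a ×ℂ Ioo 0 1 := rfl

lemma isCompact_rect (a : ℝ) : IsCompact (rect a) :=
  isCompact_Icc.reProdIm isCompact_Icc

lemma isOpen_openRect (a : ℝ) : IsOpen (openRect a) :=
  isOpen_Ioo.reProdIm isOpen_Ioo

lemma convex_rect (a : ℝ) : Convex ℝ (rect a) :=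
  ((convex_Icc 0 a).linear_preimage reLm).inter ((convex_Icc 0 1).linear_preimage imLm)

lemma interior_rect (a : ℝ) : interior (rect a) = openRect a := by
  rw [rect_eq_reProdIm, interior_reProdIm, interior_Icc, interior_Icc, openRect_eq_reProdIm]

lemma openRect_subset_rect (a : ℝ) : openRect a ⊆ rect a :=
  interior_rect a ▸ interior_subset

lemma rect_mono {a b : ℝ} (h : a ≤ b) : rect a ⊆ rect b :=
  fun _ hz => ⟨⟨hz.1.1, hz.1.2.trans h⟩, hz.2⟩

lemma openRect_mono {a b : ℝ} (h : a ≤ b) : openRect a ⊆ openRect b :=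
  fun _ hz => ⟨⟨hz.1.1, hz.1.2.trans_le h⟩, hz.2⟩

lemma openRect_nonempty {a : ℝ} (ha : 0 < a) : (openRect a).Nonempty :=
  ⟨⟨a / 2, 1 / 2⟩, ⟨half_pos ha, half_lt_self ha⟩, by norm_num, by norm_num⟩

lemma vertSide_subset_rect {x a : ℝ} (hx : x ∈ Icc 0 a) : vertSide x ⊆ rect a :=
  fun _ hz => ⟨hz.1 ▸ hx, hz.2⟩

lemma zero_mem_vertSide : (0 : ℂ) ∈ vertSide 0 := by simp [vertSide]

lemma I_mem_vertSide : I ∈ vertSide 0 := by simp [vertSide]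

/-- The inverse of a map that is injective on the rectangle `rect R`. -/
def rectInv (R : ℝ) (E : ℂ → ℂ) : ℂ → ℂ := Function.invFunOn E (rect R)

lemma rectInv_mem_rect {R : ℝ} {E : ℂ → ℂ} {w : ℂ} (hw : w ∈ E '' rect R) :
    rectInv R E w ∈ rect R :=
  (surjOn_image E (rect R)).mapsTo_invFunOn hw

namespace IsConformalEmbedding

variable {R T L : ℝ} {E : ℂ → ℂ}

lemma pos_left (h : IsConformalEmbedding R T E) : 0 < R := h.pos.trans h.lt

lemma vertSide_zero_subset (h : IsConformalEmbedding R T E) : vertSide 0 ⊆ rect R :=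
  vertSide_subset_rect ⟨le_rfl, h.pos_left.le⟩

lemma isOpen_image_openRect (h : IsConformalEmbedding R T E) : IsOpen (E '' openRect R) :=
  isOpen_image_of_injOn (isOpen_openRect R) h.holo (h.injOn.mono (openRect_subset_rect R))

lemma image_openRect_eq_interior (h : IsConformalEmbedding R T E) :
    E '' openRect R = interior (E '' rect R) := by
  refine Subset.antisymm
    (interior_maximal (image_mono (openRect_subset_rect R)) h.isOpen_image_openRect) fun w hw => ?_
  obtain ⟨z, hz, rfl⟩ := interior_subset hw
  refine mem_image_of_mem E (by_contra fun hz' => ?_)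
  rw [← interior_rect] at hz'
  exact image_notMem_nhds_of_notMem_interior (isCompact_rect R) (convex_rect R)
    (interior_rect R ▸ openRect_nonempty h.pos_left) h.continuousOn h.injOn hz hz'
    (mem_interior_iff_mem_nhds.mp hw)

lemma image_openRect_subset (h : IsConformalEmbedding R T E) : E '' openRect R ⊆ openRect T := by
  rw [h.image_openRect_eq_interior, ← interior_rect T]
  exact interior_mono h.mapsTo.image_subset

lemma openRect_subset_image (h : IsConformalEmbedding R T E) (hL : rect L ⊆ E '' rect R) :
    openRect L ⊆ E '' openRect R := by
  rw [h.image_openRect_eq_interior, ← interior_rect L]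
  exact interior_mono hL

lemma re_eq_of_mem_right_side (h : IsConformalEmbedding R T E) {z : ℂ} (hz : z ∈ vertSide R) :
    (E z).re = T := by
  obtain ⟨a, b, -, -, hab, he⟩ : E z ∈ segment ℝ (E R) (E (R + I)) :=
    h.right_side ▸ mem_image_of_mem E hz
  rw [← he]
  simp only [add_re, smul_re, h.re_p₁, h.re_p₂, ← add_smul, hab, one_smul]

lemma im_mem_of_im_image_mem (h : IsConformalEmbedding R T E) {z : ℂ} (hz : z ∈ rect R)
    (hre : (E z).re ∈ Ioo 0 T) (him : (E z).im ∈ ({0, 1} : Set ℝ)) : z.im ∈ ({0, 1} : Set ℝ) := by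
  by_contra hcon
  have not_left : z.re ≠ 0 := fun h0 =>
    hre.1.ne' (h.left_side ▸ mem_image_of_mem E ⟨h0, hz.2⟩ : E z ∈ vertSide 0).1
  have not_right : z.re ≠ R := fun hR => hre.2.ne (h.re_eq_of_mem_right_side ⟨hR, hz.2⟩)
  have im_mem : z.im ∈ Ioo (0 : ℝ) 1 :=
    ⟨hz.2.1.lt_of_ne' fun h0 => hcon (.inl h0), hz.2.2.lt_of_ne fun h1 => hcon (.inr h1)⟩
  have im_image_mem : (E z).im ∈ Ioo (0 : ℝ) 1 := (h.image_openRect_subset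
    ⟨z, ⟨⟨hz.1.1.lt_of_ne' not_left, hz.1.2.lt_of_ne not_right⟩, im_mem⟩, rfl⟩).2
  rcases him with h0 | h1
  · exact im_image_mem.1.ne' h0
  · exact im_image_mem.2.ne h1

lemma rectInv_apply (h : IsConformalEmbedding R T E) {z : ℂ} (hz : z ∈ rect R) :
    rectInv R E (E z) = z :=
  h.injOn.leftInvOn_invFunOn hz

lemma continuousOn_rectInv (h : IsConformalEmbedding R T E) :
    ContinuousOn (rectInv R E) (E '' rect R) :=
  continuousOn_invFunOn_image (isCompact_rect R) h.continuousOn h.injOn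

lemma differentiableOn_rectInv (h : IsConformalEmbedding R T E) :
    DifferentiableOn ℂ (rectInv R E) (E '' openRect R) := by
  refine differentiableOn_of_continuousOn_rightInvOn (isOpen_openRect R) h.isOpen_image_openRect
    h.holo (h.continuousOn_rectInv.mono (image_mono (openRect_subset_rect R))) ?_ ?_
  all_goals
    rintro _ ⟨z, hz, rfl⟩
    rw [h.rectInv_apply (openRect_subset_rect R hz)]
  exact hz

lemma re_rectInv_of_mem_left_side (h : IsConformalEmbedding R T E) {w : ℂ} (hw : w ∈ vertSide 0) :
    (rectInv R E w).re = 0 := by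
  rw [← h.left_side] at hw
  obtain ⟨z, hz, rfl⟩ := hw
  rw [h.rectInv_apply (h.vertSide_zero_subset hz), hz.1]

lemma im_rectInv_mul_I (h : IsConformalEmbedding R T E) {k : ℝ} (hk : k ∈ ({0, 1} : Set ℝ)) :
    (rectInv R E (k * I)).im = k := by
  rcases hk with rfl | rfl
  · have := h.rectInv_apply (h.vertSide_zero_subset zero_mem_vertSide)
    simp_all [h.map_zero]
  · have := h.rectInv_apply (h.vertSide_zero_subset I_mem_vertSide)
    simp_all [h.map_I]

lemma im_rectInv_of_im_mem (h : IsConformalEmbedding R T E) (hLT : L < T)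
    (hL : rect L ⊆ E '' rect R) {w : ℂ} (hw : w ∈ rect L) (him : w.im ∈ ({0, 1} : Set ℝ)) :
    (rectInv R E w).im = w.im := by
  set side : ℝ → ℂ := fun x => x + w.im * I
  have side_mem : MapsTo side (Icc 0 L) (rect L) := fun x hx =>
    ⟨by simpa [side] using hx, by simpa [side] using hw.2⟩
  have side_continuous : Continuous side := by fun_prop
  have continuous_im_side : ContinuousOn (fun x => (rectInv R E (side x)).im) (Icc 0 L) :=
    continuous_im.comp_continuousOn
      ((h.continuousOn_rectInv.mono hL).comp side_continuous.continuousOn side_mem)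
  have im_side_mem : MapsTo (fun x => (rectInv R E (side x)).im) (Icc 0 L) {0, 1} := by
    intro x hx
    rcases hx.1.eq_or_lt with rfl | hx0
    · simpa [side, h.im_rectInv_mul_I him] using him
    · obtain ⟨z, hz, hzx⟩ := hL (side_mem hx)
      simp only [← hzx, h.rectInv_apply hz]
      refine h.im_mem_of_im_image_mem hz ?_ ?_ <;> rw [hzx]
      · simpa [side] using ⟨hx0, hx.2.trans_lt hLT⟩
      · simpa [side] using him
  have im_side_eq := isPreconnected_Icc.constant_of_mapsTo (toFinite ({0, 1} : Set ℝ)).isDiscrete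
    continuous_im_side im_side_mem hw.1 ⟨le_rfl, hw.1.1.trans hw.1.2⟩
  simpa [side, h.im_rectInv_mul_I him, re_add_im] using im_side_eq

end IsConformalEmbedding

/-! ### Fourier series on the half period `[0,1]` -/

/-- The extension of `D : [0,1] → ℂ` to `[-1,1]` with even real part and odd imaginary part. -/
def conjReflect (D : ℝ → ℂ) (y : ℝ) : ℂ := if y ≤ 0 then conj (D (-y)) else D y

/-- The Fourier coefficients of the extension `conjReflect D`, regarded as a function of period
`2`. They are real, and determined by the restriction of `D` to `[0,1]`. -/
def halfFourierCoeff (D : ℝ → ℂ) (n : ℤ) : ℝ :=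
  (∫ y in (0 : ℝ)..1, D y * exp (-(Real.pi * n * y * I))).re

section HalfFourier

variable {D : ℝ → ℂ} {y : ℝ}

lemma conjReflect_neg (hy : 0 ≤ y) : conjReflect D (-y) = conj (D y) := by
  simp [conjReflect, hy]

lemma conjReflect_of_nonneg (h0 : (D 0).im = 0) (hy : 0 ≤ y) : conjReflect D y = D y := by
  rcases hy.eq_or_lt with rfl | hy
  · simp [conjReflect, conj_eq_iff_im.mpr h0]
  · simp [conjReflect, not_le.mpr hy]

lemma continuousOn_conjReflect (hD : ContinuousOn D (Icc 0 1)) (h0 : (D 0).im = 0) :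
    ContinuousOn (conjReflect D) (Icc (-1) 1) := by
  rw [← Icc_union_Icc_eq_Icc (neg_one_lt_zero.le) zero_le_one]
  refine ContinuousOn.union_of_isClosed ?_ ?_ isClosed_Icc isClosed_Icc
  · refine (continuous_conj.comp_continuousOn (hD.comp continuous_neg.continuousOn
      fun y hy => ?_)).congr fun y hy => by simp [conjReflect, hy.2]
    exact ⟨neg_nonneg.mpr hy.2, by linarith [hy.1]⟩
  · exact hD.congr fun y hy => conjReflect_of_nonneg h0 hy.1

lemma integral_conjReflect_left (n : ℤ) :
    ∫ y in (-1 : ℝ)..0, exp (-(Real.pi * n * y * I)) * conjReflect D y =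
      conj (∫ y in (0 : ℝ)..1, D y * exp (-(Real.pi * n * y * I))) := by
  have reflect := intervalIntegral.integral_comp_neg (a := 0) (b := 1)
    (fun y : ℝ => exp (-(Real.pi * n * y * I)) * conjReflect D y)
  rw [neg_zero] at reflect
  rw [← reflect, ← intervalIntegral.intervalIntegral_conj]
  refine intervalIntegral.integral_congr fun y hy => ?_
  rw [uIcc_of_le zero_le_one] at hy
  simp only [conjReflect_neg hy.1, map_mul, ← exp_conj, map_neg, conj_ofReal, conj_I,
    map_intCast, ofReal_neg]
  ring_nf

lemma integral_conjReflect_right (h0 : (D 0).im = 0) (n : ℤ) :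
    ∫ y in (0 : ℝ)..1, exp (-(Real.pi * n * y * I)) * conjReflect D y =
      ∫ y in (0 : ℝ)..1, D y * exp (-(Real.pi * n * y * I)) := by
  refine intervalIntegral.integral_congr fun y hy => ?_
  rw [uIcc_of_le zero_le_one] at hy
  simp only [conjReflect_of_nonneg h0 hy.1, mul_comm]

lemma fourierCoeffOn_conjReflect (hD : ContinuousOn D (Icc 0 1)) (h0 : (D 0).im = 0) (n : ℤ) :
    fourierCoeffOn (by norm_num : (-1 : ℝ) < -1 + 2) (conjReflect D) n = halfFourierCoeff D n := by
  have fourier_eq (y : ℝ) : fourier (-n) (y : AddCircle ((-1 : ℝ) + 2 - -1)) =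
      exp (-(Real.pi * n * y * I)) := by
    rw [fourier_coe_apply]
    push_cast
    ring_nf
  have integrable {a b : ℝ} (hab : uIcc a b ⊆ Icc (-1) 1) :
      IntervalIntegrable (fun y : ℝ => exp (-(Real.pi * n * y * I)) * conjReflect D y)
        volume a b :=
    (ContinuousOn.mul (by fun_prop) ((continuousOn_conjReflect hD h0).mono hab)).intervalIntegrable
  rw [fourierCoeffOn_eq_integral]
  simp only [fourier_eq, smul_eq_mul]
  rw [show (-1 : ℝ) + 2 = 1 by norm_num, ← intervalIntegral.integral_add_adjacent_intervals
    (integrable (b := 0) (uIcc_subset_Icc (by norm_num) (by norm_num)))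
    (integrable (uIcc_subset_Icc (by norm_num) (by norm_num))),
    integral_conjReflect_left, integral_conjReflect_right h0, add_comm, add_conj, halfFourierCoeff]
  norm_num
  ring

lemma hasSum_halfFourierCoeff (hD : ContinuousOn D (Icc 0 1)) (h0 : (D 0).im = 0)
    (h1 : (D 1).im = 0) (hsum : Summable (halfFourierCoeff D)) (hy : y ∈ Icc 0 1) :
    HasSum (fun n : ℤ => (halfFourierCoeff D n : ℂ) * exp (Real.pi * n * y * I)) (D y) := by
  have : Fact ((0 : ℝ) < 2) := ⟨two_pos⟩
  have endpoint : (-1 : ℝ) + 2 = 1 := by norm_num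
  have periodic : conjReflect D (-1) = conjReflect D (-1 + 2) := by
    rw [endpoint, conjReflect_neg zero_le_one, conjReflect_of_nonneg h0 zero_le_one,
      conj_eq_iff_im.mpr h1]
  let f : C(AddCircle (2 : ℝ), ℂ) := ⟨AddCircle.liftIoc 2 (-1) (conjReflect D),
    AddCircle.liftIoc_continuous periodic
      (by rw [endpoint]; exact continuousOn_conjReflect hD h0)⟩
  have coeff_eq : fourierCoeff f = fun n => (halfFourierCoeff D n : ℂ) := funext fun n =>
    (fourierCoeff_liftIoc_eq _ _).trans (fourierCoeffOn_conjReflect hD h0 n)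
  have f_apply : f (y : AddCircle (2 : ℝ)) = D y := by
    change AddCircle.liftIoc 2 (-1) (conjReflect D) y = D y
    rw [AddCircle.liftIoc_coe_apply ⟨by linarith [hy.1], by linarith [hy.2]⟩,
      conjReflect_of_nonneg h0 hy.1]
  have fourier_hasSum := has_pointwise_sum_fourier_series_of_summable (f := f)
    (coeff_eq ▸ ofRealCLM.summable hsum) (y : AddCircle (2 : ℝ))
  rw [f_apply, coeff_eq] at fourier_hasSum
  refine fourier_hasSum.congr_fun fun n => ?_
  rw [fourier_coe_apply, smul_eq_mul]
  push_cast
  ring_nf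

lemma halfFourierCoeff_neg (hre : ∀ y ∈ Icc (0 : ℝ) 1, (D y).re = 0) (n : ℤ) :
    halfFourierCoeff D (-n) = -halfFourierCoeff D n := by
  suffices ∫ y in (0 : ℝ)..1, D y * exp (-(Real.pi * (-n : ℤ) * y * I)) =
      -conj (∫ y in (0 : ℝ)..1, D y * exp (-(Real.pi * n * y * I))) by
    simp only [halfFourierCoeff, this, neg_re, conj_re]
  rw [← intervalIntegral.intervalIntegral_conj, ← intervalIntegral.integral_neg]
  refine intervalIntegral.integral_congr fun y hy => ?_
  rw [uIcc_of_le zero_le_one] at hy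
  have conj_eq : conj (D y) = -D y := Complex.ext (by simp [hre y hy]) (by simp)
  simp [← exp_conj, conj_eq]

lemma halfFourierCoeff_sub_neg (hD : ContinuousOn D (Icc 0 1)) (n : ℤ) :
    halfFourierCoeff D n - halfFourierCoeff D (-n) =
      ∫ y in (0 : ℝ)..1, 2 * ((D y).im * Real.sin (Real.pi * n * y)) := by
  have integrable (m : ℤ) :
      IntervalIntegrable (fun y : ℝ => D y * exp (-(Real.pi * m * y * I))) volume 0 1 := by
    refine ContinuousOn.intervalIntegrable ?_
    rw [uIcc_of_le zero_le_one]
    exact hD.mul (by fun_prop)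
  rw [halfFourierCoeff, halfFourierCoeff, ← sub_re,
    ← intervalIntegral.integral_sub (integrable n) (integrable (-n)), ← reCLM_apply,
    ← reCLM.intervalIntegral_comp_comm ((integrable n).sub (integrable (-n)))]
  refine intervalIntegral.integral_congr fun y _ => ?_
  have exp_eq : exp (-(Real.pi * n * y * I)) - exp (-(Real.pi * (-n : ℤ) * y * I)) =
      (-(2 * Real.sin (Real.pi * n * y)) : ℝ) * I := by
    push_cast
    rw [Complex.sin]
    ring_nf
    simp
    ring
  simp only [reCLM_apply, ← mul_sub, exp_eq, mul_re, mul_im, ofReal_re, ofReal_im, I_re, I_im]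
  ring

lemma abs_halfFourierCoeff_sub_neg_le {B : ℝ} (hD : ContinuousOn D (Icc 0 1))
    (hB : ∀ y ∈ Icc (0 : ℝ) 1, |(D y).im| ≤ B) (n : ℤ) :
    |halfFourierCoeff D n - halfFourierCoeff D (-n)| ≤ 2 * B := by
  rw [halfFourierCoeff_sub_neg hD, ← Real.norm_eq_abs]
  refine (intervalIntegral.norm_integral_le_of_norm_le_const (C := 2 * B) fun y hy => ?_).trans
    (by simp)
  rw [uIoc_of_le zero_le_one] at hy
  rw [Real.norm_eq_abs, abs_mul, abs_mul, abs_two]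
  have im_le := hB y ⟨hy.1.le, hy.2⟩
  gcongr
  exact (mul_le_of_le_one_right (abs_nonneg _) (Real.abs_sin_le_one _)).trans im_le

end HalfFourier

/-! ### Series of hyperbolic sines -/

/-- The series `∑ aₙ sinh (π (n + 1) z)`: odd, `2i`-periodic, and real on the real axis. -/
def sinhSeries (a : ℕ → ℝ) (z : ℂ) : ℂ := ∑' n : ℕ, (a n : ℂ) * sinh (Real.pi * (n + 1) * z)

lemma exp_neg_pi_mul_sub_lt_one {x L : ℝ} (h : x < L) : Real.exp (-(Real.pi * (L - x))) < 1 :=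
  Real.exp_lt_one_iff.mpr (neg_neg_of_pos (mul_pos Real.pi_pos (sub_pos.mpr h)))

lemma norm_sinh_le (w : ℂ) : ‖sinh w‖ ≤ Real.exp |w.re| := by
  rw [sinh, norm_div, Complex.norm_two, div_le_iff₀ two_pos]
  refine (norm_sub_le _ _).trans ?_
  rw [norm_exp, norm_exp, neg_re]
  linarith [Real.exp_le_exp.mpr (le_abs_self w.re), Real.exp_le_exp.mpr (neg_le_abs w.re)]

lemma hasSum_sinh_of_odd {s : ℤ → ℂ} {w v : ℂ} (hodd : ∀ n, s (-n) = -s n)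
    (hs : HasSum (fun n : ℤ => s n * exp (n * w)) v) :
    HasSum (fun n : ℕ => 2 * s (n + 1) * sinh ((n + 1) * w)) v := by
  have s_zero : s 0 = 0 := by simpa using self_eq_neg.mp (hodd 0)
  have paired := (hasSum_nat_add_iff' 1).mpr hs.nat_add_neg
  simp only [Finset.range_one, Finset.sum_singleton, Nat.cast_zero, neg_zero, s_zero, zero_mul,
    add_zero, sub_zero] at paired
  refine paired.congr_fun fun n => ?_
  rw [hodd, sinh]
  push_cast
  ring_nf

section SinhSeries

variable {a : ℕ → ℝ} {z : ℂ}

lemma sinhSeries_conj (a : ℕ → ℝ) (z : ℂ) : sinhSeries a (conj z) = conj (sinhSeries a z) := by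
  rw [sinhSeries, sinhSeries, conj_tsum]
  refine tsum_congr fun n => ?_
  simp [← sinh_conj]

lemma sinhSeries_neg (a : ℕ → ℝ) (z : ℂ) : sinhSeries a (-z) = -sinhSeries a z := by
  simp only [sinhSeries, mul_neg, sinh_neg, tsum_neg]

lemma sinhSeries_add_two_I (a : ℕ → ℝ) (z : ℂ) : sinhSeries a (z + 2 * I) = sinhSeries a z := by
  refine tsum_congr fun n => ?_
  rw [← sinh_periodic.nat_mul (n + 1) (Real.pi * (n + 1) * z)]
  push_cast
  ring_nf

lemma im_sinhSeries_eq_zero (hz : z.im ∈ ({0, 1} : Set ℝ)) : (sinhSeries a z).im = 0 := by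
  rw [← conj_eq_iff_im, ← sinhSeries_conj]
  rcases hz with h0 | h1
  · rw [conj_eq_iff_im.mpr h0]
  · rw [← sinhSeries_add_two_I]
    refine congrArg _ (Complex.ext (by simp) ?_)
    simp [mem_singleton_iff.mp h1]
    norm_num

lemma re_sinhSeries_eq_zero (hz : z.re = 0) : (sinhSeries a z).re = 0 := by
  have conj_eq : conj z = -z := Complex.ext (by simp [hz]) (by simp)
  have := congrArg re (sinhSeries_conj a z)
  rw [conj_eq, sinhSeries_neg, neg_re, conj_re] at this
  linarith

variable {A L r : ℝ}

lemma norm_sinhSeries_term_le (ha : ∀ n, |a n| ≤ A * Real.exp (-(Real.pi * (n + 1) * L)))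
    (hz : |z.re| ≤ r) (n : ℕ) :
    ‖(a n : ℂ) * sinh (Real.pi * (n + 1) * z)‖ ≤
      A * Real.exp (-(Real.pi * (L - r))) * Real.exp (-(Real.pi * (L - r))) ^ n := by
  have abs_re_le : |(Real.pi * (n + 1) * z : ℂ).re| ≤ Real.pi * (n + 1) * r := by
    have : (Real.pi * (n + 1) * z : ℂ).re = Real.pi * (n + 1) * z.re := by simp
    rw [this, abs_mul, abs_of_pos (by positivity)]
    gcongr
  rw [norm_mul, norm_real, Real.norm_eq_abs]
  calc |a n| * ‖sinh (Real.pi * (n + 1) * z)‖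
      ≤ A * Real.exp (-(Real.pi * (n + 1) * L)) * Real.exp (Real.pi * (n + 1) * r) :=
        mul_le_mul (ha n) ((norm_sinh_le _).trans (Real.exp_le_exp.mpr abs_re_le))
          (norm_nonneg _) ((abs_nonneg _).trans (ha n))
    _ = A * Real.exp (-(Real.pi * (L - r))) * Real.exp (-(Real.pi * (L - r))) ^ n := by
        rw [mul_assoc A, mul_assoc A, ← Real.exp_add, ← Real.exp_nat_mul, ← Real.exp_add]
        ring_nf

lemma differentiableOn_sinhSeries (ha : ∀ n, |a n| ≤ A * Real.exp (-(Real.pi * (n + 1) * L)))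
    (hr : r < L) :
    DifferentiableOn ℂ (sinhSeries a) {z | |z.re| < r} :=
  differentiableOn_tsum_of_summable_norm
    ((summable_geometric_of_lt_one (Real.exp_pos _).le (exp_neg_pi_mul_sub_lt_one hr)).mul_left _)
    (fun n => by fun_prop) (isOpen_lt (by fun_prop) continuous_const)
    (fun n w hw => norm_sinhSeries_term_le ha (le_of_lt hw) n)

lemma norm_sinhSeries_le (ha : ∀ n, |a n| ≤ A * Real.exp (-(Real.pi * (n + 1) * L)))
    (hr : r < L) (hz : |z.re| ≤ r) :
    ‖sinhSeries a z‖ ≤ A * Real.exp (-(Real.pi * (L - r))) *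
      (1 - Real.exp (-(Real.pi * (L - r))))⁻¹ :=
  tsum_of_norm_bounded ((hasSum_geometric_of_lt_one (Real.exp_pos _).le
    (exp_neg_pi_mul_sub_lt_one hr)).mul_left _)
    (norm_sinhSeries_term_le ha hz)

end SinhSeries

/-! ### Reflectable functions -/

/-- A holomorphic function on a rectangle which is real on the horizontal sides and imaginary on
the left side, so that it can be continued by reflection across these three sides. -/
structure IsReflectable (L : ℝ) (G : ℂ → ℂ) : Prop where
  continuousOn : ContinuousOn G (rect L)
  holo : DifferentiableOn ℂ G (openRect L)
  im_eq_zero : ∀ w ∈ rect L, w.im ∈ ({0, 1} : Set ℝ) → (G w).im = 0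
  re_eq_zero : ∀ w ∈ vertSide 0, (G w).re = 0

/-- The coefficients `halfFourierCoeff` of `G` along the vertical segment with abscissa `x`. -/
def sliceCoeff (G : ℂ → ℂ) (n : ℤ) (x : ℝ) : ℝ := halfFourierCoeff (fun y => G (x + y * I)) n

lemma add_mul_I_mem_rect {L x y : ℝ} (hx : x ∈ Icc 0 L) (hy : y ∈ Icc (0 : ℝ) 1) :
    (x + y * I : ℂ) ∈ rect L :=
  ⟨by simpa using hx, by simpa using hy⟩

lemma im_integral_eq_zero {f : ℝ → ℂ} {a b : ℝ} (hf : ∀ t ∈ uIcc a b, (f t).im = 0) :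
    (∫ t in a..b, f t).im = 0 := by
  rw [intervalIntegral.integral_congr (g := fun t => ((f t).re : ℂ))
    fun t ht => Complex.ext (by simp) (by simp [hf t ht]),
    intervalIntegral.integral_ofReal, ofReal_im]

/-- Cauchy's theorem: the horizontal sides contribute nothing to the imaginary part. -/
lemma re_integral_vertSide_eq {x : ℝ} {g : ℂ → ℂ} (hx : 0 ≤ x) (hc : ContinuousOn g (rect x))
    (hd : DifferentiableOn ℂ g (openRect x))
    (him : ∀ w ∈ rect x, w.im ∈ ({0, 1} : Set ℝ) → (g w).im = 0) :
    (∫ y in (0 : ℝ)..1, g (x + y * I)).re = (∫ y in (0 : ℝ)..1, g (y * I)).re := by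
  have horizontal {k : ℝ} (hk : k ∈ ({0, 1} : Set ℝ)) :
      (∫ t in (0 : ℝ)..x, g (t + k * I)).im = 0 := by
    refine im_integral_eq_zero fun t ht => him _ (add_mul_I_mem_rect ?_ ?_) (by simpa using hk)
    · rwa [uIcc_of_le hx] at ht
    · rcases hk with rfl | rfl <;> simp
  have cauchy := congrArg im (integral_boundary_rect_eq_zero_of_continuousOn_of_differentiableOn
    g 0 (x + I) (by simpa [uIcc_of_le hx, ← rect_eq_reProdIm] using hc)
    (by simpa [hx, ← openRect_eq_reProdIm] using hd))
  have bottom := horizontal (.inl rfl)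
  have top := horizontal (.inr rfl)
  simp only [ofReal_zero, zero_mul, add_zero, ofReal_one, one_mul] at bottom top
  simp only [zero_re, add_re, ofReal_re, I_re, add_zero, zero_im, add_im, ofReal_im, I_im,
    zero_add, smul_eq_mul, sub_im, I_mul_im, ofReal_zero, ofReal_one, zero_mul, one_mul,
    bottom, top] at cauchy
  linarith

lemma im_exp_neg_pi_int_mul {w : ℂ} (hw : w.im ∈ ({0, 1} : Set ℝ)) (n : ℤ) :
    (exp (-(Real.pi * n * w))).im = 0 := by
  have im_eq : (-(Real.pi * n * w) : ℂ).im = -(n * w.im * Real.pi) := by simp; ring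
  rw [exp_im, im_eq, Real.sin_neg]
  rcases hw with h | h <;> simp [mem_singleton_iff.mp h, Real.sin_int_mul_pi]

namespace IsReflectable

variable {L B : ℝ} {G : ℂ → ℂ}

lemma mono (hG : IsReflectable L G) {x : ℝ} (hx : x ≤ L) : IsReflectable x G where
  continuousOn := hG.continuousOn.mono (rect_mono hx)
  holo := hG.holo.mono (openRect_mono hx)
  im_eq_zero w hw := hG.im_eq_zero w (rect_mono hx hw)
  re_eq_zero := hG.re_eq_zero

lemma continuousOn_slice (hG : IsReflectable L G) {x : ℝ} (hx : x ∈ Icc 0 L) :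
    ContinuousOn (fun y : ℝ => G (x + y * I)) (Icc 0 1) :=
  hG.continuousOn.comp (by fun_prop) fun _ hy => add_mul_I_mem_rect hx hy

lemma sliceCoeff_eq (hG : IsReflectable L G) (n : ℤ) {x : ℝ} (hx : x ∈ Icc 0 L) :
    sliceCoeff G n x = sliceCoeff G n 0 * Real.exp (Real.pi * n * x) := by
  have slice_eq : ∫ y in (0 : ℝ)..1, G (x + y * I) * exp (-(Real.pi * n * (x + y * I))) =
      (Real.exp (-(Real.pi * n * x)) : ℝ) *
        ∫ y in (0 : ℝ)..1, G (x + y * I) * exp (-(Real.pi * n * y * I)) := by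
    rw [← intervalIntegral.integral_const_mul]
    refine intervalIntegral.integral_congr fun y _ => ?_
    rw [mul_left_comm, ofReal_exp, ← exp_add]
    push_cast
    ring_nf
  have hGx : IsReflectable x G := hG.mono hx.2
  have cauchy := re_integral_vertSide_eq (g := fun z => G z * exp (-(Real.pi * n * z)))
    hx.1 (hGx.continuousOn.mul (by fun_prop)) (hGx.holo.mul (by fun_prop))
    (fun w hw him => by simp [hGx.im_eq_zero w hw him, im_exp_neg_pi_int_mul him n])
  rw [slice_eq, re_ofReal_mul, Real.exp_neg, inv_mul_eq_iff_eq_mul₀ (Real.exp_ne_zero _)] at cauchy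
  rw [sliceCoeff, halfFourierCoeff, cauchy, mul_comm]
  simp only [sliceCoeff, halfFourierCoeff, ofReal_zero, zero_add, mul_assoc]

lemma sliceCoeff_neg (hG : IsReflectable L G) (n : ℤ) :
    sliceCoeff G (-n) 0 = -sliceCoeff G n 0 :=
  halfFourierCoeff_neg (fun y hy => hG.re_eq_zero _ ⟨by simp, by simpa using hy⟩) n

lemma abs_sliceCoeff_le (hG : IsReflectable L G) (hL : 0 ≤ L)
    (hB : ∀ w ∈ rect L, |(G w).im| ≤ B) (n : ℤ) :
    |sliceCoeff G n 0| ≤ 2 * B * Real.exp (-(Real.pi * |n| * L)) := by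
  have hLmem : L ∈ Icc 0 L := ⟨hL, le_rfl⟩
  have right_side : |sliceCoeff G n L - sliceCoeff G (-n) L| ≤ 2 * B :=
    abs_halfFourierCoeff_sub_neg_le (hG.continuousOn_slice hLmem)
      (fun y hy => hB _ (add_mul_I_mem_rect hLmem hy)) n
  rw [hG.sliceCoeff_eq n hLmem, hG.sliceCoeff_eq (-n) hLmem, hG.sliceCoeff_neg, neg_mul,
    sub_neg_eq_add, ← mul_add, abs_mul] at right_side
  rw [Real.exp_neg, ← div_eq_mul_inv, le_div_iff₀ (Real.exp_pos _)]
  refine (mul_le_mul_of_nonneg_left ?_ (abs_nonneg _)).trans right_side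
  refine le_trans ?_ (le_abs_self _)
  push_cast
  rcases abs_cases (n : ℝ) with ⟨habs, -⟩ | ⟨habs, -⟩ <;> rw [habs] <;>
    linarith [Real.exp_pos (Real.pi * n * L), Real.exp_pos (Real.pi * -n * L)]

lemma summable_sliceCoeff (hG : IsReflectable L G) (hB : ∀ w ∈ rect L, |(G w).im| ≤ B) {x : ℝ}
    (hx : x ∈ Ico 0 L) : Summable fun n : ℤ => sliceCoeff G n x := by
  have geometric : Summable fun n : ℤ => 2 * B * Real.exp (-(Real.pi * (L - x))) ^ n.natAbs := by
    have := summable_geometric_of_lt_one (Real.exp_pos (-(Real.pi * (L - x)))).le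
      (exp_neg_pi_mul_sub_lt_one hx.2)
    refine (Summable.of_nat_of_neg ?_ ?_).mul_left (2 * B) <;> simpa using this
  refine Summable.of_norm_bounded geometric fun n => ?_
  rw [hG.sliceCoeff_eq n ⟨hx.1, hx.2.le⟩, Real.norm_eq_abs, abs_mul, Real.abs_exp]
  calc |sliceCoeff G n 0| * Real.exp (Real.pi * n * x)
      ≤ 2 * B * Real.exp (-(Real.pi * |n| * L)) * Real.exp (Real.pi * |n| * x) := by
        have coeff_le := hG.abs_sliceCoeff_le (hx.1.trans hx.2.le) hB n
        gcongr
        · exact (abs_nonneg _).trans coeff_le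
        · exact hx.1
        · exact_mod_cast le_abs_self n
    _ = 2 * B * Real.exp (-(Real.pi * (L - x))) ^ n.natAbs := by
        rw [mul_assoc, ← Real.exp_add, ← Real.exp_nat_mul, Nat.cast_natAbs]
        ring_nf

lemma hasSum_sliceCoeff (hG : IsReflectable L G) (hB : ∀ w ∈ rect L, |(G w).im| ≤ B) {w : ℂ}
    (hw : w ∈ rect L) (hwL : w.re < L) :
    HasSum (fun n : ℤ => (sliceCoeff G n 0 : ℂ) * exp (Real.pi * n * w)) (G w) := by
  have fourier := hasSum_halfFourierCoeff (hG.continuousOn_slice hw.1)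
    (hG.im_eq_zero _ (add_mul_I_mem_rect hw.1 (by simp)) (by simp))
    (hG.im_eq_zero _ (add_mul_I_mem_rect hw.1 (by simp)) (by simp))
    (hG.summable_sliceCoeff hB ⟨hw.1.1, hwL⟩) hw.2
  rw [re_add_im] at fourier
  refine fourier.congr_fun fun n => ?_
  change _ = (sliceCoeff G n w.re : ℂ) * _
  rw [hG.sliceCoeff_eq n hw.1, ofReal_mul, ofReal_exp, mul_assoc (sliceCoeff G n 0 : ℂ),
    ← exp_add]
  congr 2
  conv_lhs => rw [← re_add_im w]
  push_cast
  ring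

lemma eq_sinhSeries (hG : IsReflectable L G) (hB : ∀ w ∈ rect L, |(G w).im| ≤ B) {w : ℂ}
    (hw : w ∈ rect L) (hwL : w.re < L) :
    G w = sinhSeries (fun n => 2 * sliceCoeff G (n + 1) 0) w := by
  have exponential : HasSum (fun n : ℤ => (sliceCoeff G n 0 : ℂ) * exp (n * (Real.pi * w))) (G w) :=
    (hG.hasSum_sliceCoeff hB hw hwL).congr_fun fun n => by ring_nf
  have sinh_sum := hasSum_sinh_of_odd (fun n => by rw [hG.sliceCoeff_neg, ofReal_neg]) exponential
  rw [← sinh_sum.tsum_eq, sinhSeries]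
  refine tsum_congr fun n => ?_
  push_cast
  ring_nf

lemma exists_eq_sinhSeries (hG : IsReflectable L G) (hL : 0 ≤ L)
    (hB : ∀ w ∈ rect L, |(G w).im| ≤ B) :
    ∃ a : ℕ → ℝ, (∀ n, |a n| ≤ 4 * B * Real.exp (-(Real.pi * (n + 1) * L))) ∧
      ∀ w ∈ rect L, w.re < L → G w = sinhSeries a w := by
  refine ⟨_, fun n => ?_, fun w hw hwL => hG.eq_sinhSeries hB hw hwL⟩
  have coeff_le := hG.abs_sliceCoeff_le hL hB (n + 1)
  rw [abs_of_nonneg (by positivity : (0 : ℤ) ≤ n + 1)] at coeff_le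
  rw [abs_mul, abs_two]
  push_cast at coeff_le
  linarith

end IsReflectable

/-! ### Contractive perturbations of the identity -/

section IdAdd

variable {V : Type*} [NormedAddCommGroup V] [NormedSpace ℝ V] {h : V → V} {c : NNReal}

lemma approximatesLinearOn_id_add (hh : LipschitzWith c h) :
    ApproximatesLinearOn (fun z => z + h z) (ContinuousLinearEquiv.refl ℝ V : V →L[ℝ] V) univ
      c := by
  intro x _ y _
  rw [ContinuousLinearEquiv.coe_refl, ContinuousLinearMap.id_apply,
    show x + h x - (y + h y) - (x - y) = h x - h y by abel]
  exact hh.norm_sub_le x y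

/-- The homeomorphism `z ↦ z + h z` of a Banach space for a contraction `h`. -/
def idAddHomeomorph [CompleteSpace V] (hh : LipschitzWith c h) (hc : c < 1) : V ≃ₜ V :=
  (approximatesLinearOn_id_add hh).toHomeomorph _ <| by
    rcases subsingleton_or_nontrivial V with _ | _
    · exact .inl ‹_›
    · exact .inr (by simpa using hc)

@[simp]
lemma idAddHomeomorph_apply [CompleteSpace V] (hh : LipschitzWith c h) (hc : c < 1) (z : V) :
    idAddHomeomorph hh hc z = z + h z := rfl

end IdAdd

lemma norm_sub_div_circleMap_lt_one {h : ℂ → ℂ} {c : NNReal} (hh : LipschitzWith c h) (hc : c < 1)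
    (z : ℂ) {r : ℝ} (hr : r ≠ 0) (t : ℝ) :
    ‖(h (circleMap z r t) - h z) / circleMap 0 r t‖ < 1 := by
  have radius_pos : 0 < ‖circleMap 0 r t‖ := by simpa using hr
  have contraction := hh.norm_sub_le (circleMap z r t) z
  rw [circleMap_sub_center] at contraction
  rw [norm_div, div_lt_one radius_pos]
  exact contraction.trans_lt (mul_lt_of_lt_one_left radius_pos hc)

/-- Along a circle about `z`, the increment of `w ↦ w + h w` is `(w - z) (1 + u)` with `‖u‖ < 1`,
so the principal argument of `1 + u` corrects the angle of `w - z` to a continuous lift. -/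
lemma orientationPreservingOn_id_add {h : ℂ → ℂ} {c : NNReal} (hh : LipschitzWith c h)
    (hc : c < 1) (Ω : Set ℂ) : OrientationPreservingOn (fun z => z + h z) Ω := by
  intro z _ r hr _
  set u : ℝ → ℂ := fun t => (h (circleMap z r t) - h z) / circleMap 0 r t with hu
  have circle_ne : ∀ t, circleMap 0 r t ≠ 0 := fun t => circleMap_ne_center hr.ne'
  have u_continuous : Continuous u :=
    ((hh.continuous.comp (continuous_circleMap z r)).sub continuous_const).div
      (continuous_circleMap 0 r) circle_ne
  have mem_slit : ∀ t, 1 + u t ∈ slitPlane := fun t =>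
    mem_slitPlane_of_norm_lt_one (norm_sub_div_circleMap_lt_one hh hc z hr.ne' t)
  have increment : ∀ t, circleMap z r t + h (circleMap z r t) - (z + h z)
      = circleMap 0 r t * (1 + u t) := fun t => by
    rw [mul_add, mul_div_cancel₀ _ (circle_ne t), ← circleMap_sub_center z r t]
    ring
  refine ⟨fun t => t + arg (1 + u t), ?_, fun t => ?_, ?_⟩
  · exact continuous_id.add <| continuous_iff_continuousAt.mpr fun t =>
      (continuousAt_arg (mem_slit t)).comp (f := fun t => 1 + u t) (by fun_prop)
  · rw [increment, norm_mul, norm_circleMap_zero, abs_of_pos hr, ofReal_mul, ofReal_add, add_mul,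
      exp_add, circleMap_zero]
    nth_rewrite 1 [← norm_mul_exp_arg_mul_I (1 + u t)]
    ring
  · have periodic : u (2 * Real.pi) = u 0 := by simp [hu, circleMap]
    simp only [periodic]
    ring

/-! ### Wirtinger derivatives of Lipschitz functions -/

section WeakDerivative

variable {V : Type*} [NormedAddCommGroup V] [NormedSpace ℝ V] [MeasurableSpace V] [BorelSpace V]
  {f : V → ℂ} {c : NNReal}

lemma locallyIntegrable_fderiv_apply (hf : LipschitzWith c f) (μ : Measure V)
    [IsLocallyFiniteMeasure μ] (v : V) : LocallyIntegrable (fun z => fderiv ℝ f z v) μ := by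
  refine (locallyIntegrable_const (c * ‖v‖ : ℝ)).mono
    (measurable_fderiv_apply_const ℝ f v).aestronglyMeasurable (.of_forall fun z => ?_)
  exact ((fderiv ℝ f z).le_of_opNorm_le (norm_fderiv_le_of_lipschitz ℝ hf) v).trans
    (le_abs_self _)

variable {φ : V → ℂ} (μ : Measure V)

lemma integrable_mul_fderiv_apply [IsLocallyFiniteMeasure μ] (hf : Continuous f)
    (hφ : ContDiff ℝ 1 φ) (hφc : HasCompactSupport φ) (v : V) :
    Integrable (fun z => f z * fderiv ℝ φ z v) μ := by
  have deriv_continuous : Continuous fun z => fderiv ℝ φ z v :=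
    (hφ.continuous_fderiv one_ne_zero).clm_apply continuous_const
  simpa [mul_comm] using hf.locallyIntegrable.integrable_smul_left_of_hasCompactSupport
    deriv_continuous (hφc.fderiv_apply ℝ v)

lemma integrable_fderiv_apply_mul [IsLocallyFiniteMeasure μ] (hf : LipschitzWith c f)
    (hφ : Continuous φ) (hφc : HasCompactSupport φ) (v : V) :
    Integrable (fun z => fderiv ℝ f z v * φ z) μ := by
  simpa [mul_comm] using
    (locallyIntegrable_fderiv_apply hf μ v).integrable_smul_left_of_hasCompactSupport hφ hφc

lemma integral_mul_fderiv_apply_eq_neg [FiniteDimensional ℝ V] [μ.IsAddHaarMeasure]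
    (hf : Differentiable ℝ f) (hfc : LipschitzWith c f) (hφ : ContDiff ℝ 1 φ)
    (hφc : HasCompactSupport φ) (v : V) :
    ∫ z, f z * fderiv ℝ φ z v ∂μ = -∫ z, fderiv ℝ f z v * φ z ∂μ := by
  have product_integrable : Integrable (fun z => f z * φ z) μ := by
    simpa [mul_comm] using
      hf.continuous.locallyIntegrable.integrable_smul_left_of_hasCompactSupport hφ.continuous hφc
  exact integral_mul_fderiv_eq_neg_fderiv_mul_of_integrable
    (integrable_fderiv_apply_mul μ hfc hφ.continuous hφc v)
    (integrable_mul_fderiv_apply μ hf.continuous hφ hφc v) product_integrable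
    (fun z _ => hf z) (fun z _ => hφ.differentiable one_ne_zero z)

lemma integral_mul_fderiv_combination_eq_neg [FiniteDimensional ℝ V] [μ.IsAddHaarMeasure]
    (hf : Differentiable ℝ f) (hfc : LipschitzWith c f) (hφ : ContDiff ℝ 1 φ)
    (hφc : HasCompactSupport φ) (a b : ℂ) (v w : V) :
    ∫ z, f z * (a * fderiv ℝ φ z v + b * fderiv ℝ φ z w) ∂μ =
      -∫ z, (a * fderiv ℝ f z v + b * fderiv ℝ f z w) * φ z ∂μ := by
  have integrable_left := integrable_mul_fderiv_apply μ hf.continuous hφ hφc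
  have integrable_right := integrable_fderiv_apply_mul μ hfc hφ.continuous hφc
  simp only [mul_add, add_mul, mul_left_comm _ a, mul_left_comm _ b, mul_assoc a, mul_assoc b]
  rw [integral_add ((integrable_left v).const_mul a) ((integrable_left w).const_mul b),
    integral_add ((integrable_right v).const_mul a) ((integrable_right w).const_mul b)]
  simp only [integral_const_mul, integral_mul_fderiv_apply_eq_neg μ hf hfc hφ hφc]
  ring

end WeakDerivative

lemma wirtinger_eq_combination (f : ℂ → ℂ) :
    wirtinger f = fun z => 1 / 2 * fderiv ℝ f z 1 + -(I / 2) * fderiv ℝ f z I := by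
  funext z
  rw [wirtinger]
  ring

lemma wirtingerBar_eq_combination (f : ℂ → ℂ) :
    wirtingerBar f = fun z => 1 / 2 * fderiv ℝ f z 1 + I / 2 * fderiv ℝ f z I := by
  funext z
  rw [wirtingerBar]
  ring

lemma isWeakWirtinger_of_differentiable {f : ℂ → ℂ} {c : NNReal} (hf : Differentiable ℝ f)
    (hfc : LipschitzWith c f) (Ω : Set ℂ) :
    IsWeakWirtinger f Ω (wirtinger f) (wirtingerBar f) := by
  have combination_locallyIntegrable (a b : ℂ) :
      LocallyIntegrableOn (fun z => a * fderiv ℝ f z 1 + b * fderiv ℝ f z I) Ω :=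
    (((locallyIntegrable_fderiv_apply hfc volume 1).smul a).add
      ((locallyIntegrable_fderiv_apply hfc volume I).smul b)).locallyIntegrableOn Ω
  constructor
  · simpa only [wirtinger_eq_combination] using combination_locallyIntegrable _ _
  · simpa only [wirtingerBar_eq_combination] using combination_locallyIntegrable _ _
  · intro φ hφ hφc _
    simp only [wirtinger_eq_combination]
    exact integral_mul_fderiv_combination_eq_neg volume hf hfc (hφ.of_le (by simp)) hφc _ _ _ _
  · intro φ hφ hφc _
    simp only [wirtingerBar_eq_combination]
    exact integral_mul_fderiv_combination_eq_neg volume hf hfc (hφ.of_le (by simp)) hφc _ _ _ _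

lemma exists_norm_eq_one_norm_mul_add_mul_conj (p q : ℂ) :
    ∃ v : ℂ, ‖v‖ = 1 ∧ ‖p * v + q * conj v‖ = ‖p‖ + ‖q‖ := by
  set β : ℝ := (arg q - arg p) / 2 with hβ
  refine ⟨exp (β * I), norm_exp_ofReal_mul_I β, ?_⟩
  have common_phase : p * exp (β * I) + q * conj (exp (β * I))
      = (‖p‖ + ‖q‖ : ℝ) * exp (((arg p + arg q) / 2 : ℝ) * I) := by
    have phase_p : exp (arg p * I) * exp (β * I) = exp (((arg p + arg q) / 2 : ℝ) * I) := by
      rw [← exp_add, hβ]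
      push_cast
      ring_nf
    have phase_q : exp (arg q * I) * conj (exp (β * I)) = exp (((arg p + arg q) / 2 : ℝ) * I) := by
      rw [← exp_conj, map_mul, conj_ofReal, conj_I, ← exp_add, hβ]
      push_cast
      ring_nf
    nth_rewrite 1 [← norm_mul_exp_arg_mul_I p, ← norm_mul_exp_arg_mul_I q]
    rw [mul_assoc, mul_assoc, phase_p, phase_q, ofReal_add, add_mul]
  rw [common_phase, norm_mul, norm_exp_ofReal_mul_I, mul_one, norm_real,
    Real.norm_of_nonneg (by positivity)]

lemma norm_wirtinger_add_norm_wirtingerBar_le (f : ℂ → ℂ) (z : ℂ) :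
    ‖wirtinger f z‖ + ‖wirtingerBar f z‖ ≤ ‖fderiv ℝ f z‖ := by
  obtain ⟨v, v_norm, v_max⟩ :=
    exists_norm_eq_one_norm_mul_add_mul_conj (wirtinger f z) (wirtingerBar f z)
  have fderiv_apply_eq : wirtinger f z * v + wirtingerBar f z * conj v = fderiv ℝ f z v := by
    have expand : fderiv ℝ f z v = v.re * fderiv ℝ f z 1 + v.im * fderiv ℝ f z I := by
      conv_lhs => rw [← re_add_im v, ← mul_one (v.re : ℂ), ← real_smul, ← real_smul, map_add,
        map_smul, map_smul, real_smul, real_smul]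
    rw [expand, wirtinger, wirtingerBar]
    conv_lhs => rw [← re_add_im v]
    simp only [map_add, map_mul, conj_ofReal, conj_I]
    linear_combination -(v.im * fderiv ℝ f z I) * I_mul_I
  rw [← v_max, fderiv_apply_eq]
  simpa [v_norm] using (fderiv ℝ f z).le_opNorm v

section QuasiconformalIdAdd

variable {h : ℂ → ℂ} {c : NNReal} {z : ℂ}

lemma fderiv_id_add (hd : DifferentiableAt ℝ h z) :
    fderiv ℝ (fun z => z + h z) z = ContinuousLinearMap.id ℝ ℂ + fderiv ℝ h z :=
  ((hasFDerivAt_id z).add hd.hasFDerivAt).fderiv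

lemma wirtinger_id_add (hd : DifferentiableAt ℝ h z) :
    wirtinger (fun z => z + h z) z = 1 + wirtinger h z := by
  simp only [wirtinger, fderiv_id_add hd, add_apply, ContinuousLinearMap.id_apply]
  linear_combination -(1 / 2) * I_mul_I

lemma wirtingerBar_id_add (hd : DifferentiableAt ℝ h z) :
    wirtingerBar (fun z => z + h z) z = wirtingerBar h z := by
  simp only [wirtingerBar, fderiv_id_add hd, add_apply, ContinuousLinearMap.id_apply]
  linear_combination (1 / 2) * I_mul_I

lemma norm_wirtingerBar_id_add_le (hd : DifferentiableAt ℝ h z) (hh : LipschitzWith c h)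
    (hc : c ≤ 1) :
    ‖wirtingerBar (fun z => z + h z) z‖ ≤ c * ‖wirtinger (fun z => z + h z) z‖ := by
  rw [wirtinger_id_add hd, wirtingerBar_id_add hd]
  have sum_le : ‖wirtinger h z‖ + ‖wirtingerBar h z‖ ≤ c :=
    (norm_wirtinger_add_norm_wirtingerBar_le h z).trans (norm_fderiv_le_of_lipschitz ℝ hh)
  have one_sub_le : 1 - ‖wirtinger h z‖ ≤ ‖1 + wirtinger h z‖ := by
    simpa using norm_sub_le_norm_add 1 (wirtinger h z)
  calc ‖wirtingerBar h z‖ ≤ c - 1 * ‖wirtinger h z‖ := by linarith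
    _ ≤ c - c * ‖wirtinger h z‖ := by gcongr; exact_mod_cast hc
    _ = c * (1 - ‖wirtinger h z‖) := by ring
    _ ≤ c * ‖1 + wirtinger h z‖ := by gcongr

lemma isWeakWirtinger_id_add (hd : Differentiable ℝ h) (hh : LipschitzWith c h) (Ω : Set ℂ) :
    IsWeakWirtinger (fun z => z + h z) Ω (wirtinger fun z => z + h z)
      (wirtingerBar fun z => z + h z) :=
  isWeakWirtinger_of_differentiable (differentiable_id.add hd) (LipschitzWith.id.add hh) Ω

lemma isQuasiconformal_id_add (hd : Differentiable ℝ h) (hh : LipschitzWith c h) (hc : c < 1)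
    {Ω Ω' : Set ℂ} (hΩ : IsOpen Ω) (hΩ' : (fun z => z + h z) '' Ω = Ω') :
    IsQuasiconformal ((1 + c) / (1 - c)) (fun z => z + h z) Ω Ω' := by
  have one_sub_pos : (0 : ℝ) < 1 - c := sub_pos.mpr (by exact_mod_cast hc)
  refine ⟨?_, ?_, orientationPreservingOn_id_add hh hc Ω,
    _, _, isWeakWirtinger_id_add hd hh Ω, .of_forall fun z => ?_⟩
  · rw [one_le_div one_sub_pos]
    linarith [c.coe_nonneg]
  · exact ⟨(idAddHomeomorph hh hc).toOpenPartialHomeomorphOfImageEq Ω hΩ Ω' hΩ', rfl, rfl,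
      fun z _ => rfl⟩
  · have ratio : ((1 + c) / (1 - c) - 1) / ((1 + c) / (1 - c) + 1) = (c : ℝ) := by
      field_simp
      ring
    rw [ratio]
    exact norm_wirtingerBar_id_add_le (hd z) hh hc.le

end QuasiconformalIdAdd

/-! ### Cutting off a holomorphic function on a strip -/

/-- The `C¹` step with derivative `6 s (1 - s)` on `[0, 1]`, constant outside that interval. -/
def smoothstep (t : ℝ) : ℝ := ∫ s in (0 : ℝ)..t, 6 * max 0 (s * (1 - s))

lemma hasDerivAt_smoothstep (t : ℝ) : HasDerivAt smoothstep (6 * max 0 (t * (1 - t))) t :=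
  (Continuous.integral_hasStrictDerivAt (by fun_prop) 0 t).hasDerivAt

lemma monotone_smoothstep : Monotone smoothstep :=
  monotone_of_hasDerivAt_nonneg hasDerivAt_smoothstep fun t => by positivity

lemma smoothstep_of_nonpos {t : ℝ} (ht : t ≤ 0) : smoothstep t = 0 := by
  refine intervalIntegral.integral_zero_ae (.of_forall fun s hs => ?_)
  rw [uIoc_of_ge ht] at hs
  rw [max_eq_left (by nlinarith [hs.2]), mul_zero]

lemma smoothstep_of_one_le {t : ℝ} (ht : 1 ≤ t) : smoothstep t = 1 := by
  have integrable (a b : ℝ) :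
      IntervalIntegrable (fun s : ℝ => 6 * max 0 (s * (1 - s))) volume a b :=
    Continuous.intervalIntegrable (by fun_prop) a b
  have integral_tail : ∫ s in (1 : ℝ)..t, 6 * max 0 (s * (1 - s)) = 0 := by
    refine intervalIntegral.integral_zero_ae (.of_forall fun s hs => ?_)
    rw [uIoc_of_le ht] at hs
    rw [max_eq_left (by nlinarith [hs.1]), mul_zero]
  have integral_unit : ∫ s in (0 : ℝ)..1, 6 * max 0 (s * (1 - s)) = 1 := by
    calc ∫ s in (0 : ℝ)..1, 6 * max 0 (s * (1 - s)) = 6 * ∫ s in (0 : ℝ)..1, (s - s ^ 2) := by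
          rw [← intervalIntegral.integral_const_mul]
          refine intervalIntegral.integral_congr fun s hs => ?_
          rw [uIcc_of_le zero_le_one] at hs
          simp only [max_eq_right (mul_nonneg hs.1 (sub_nonneg.mpr hs.2))]
          ring
      _ = 1 := by
          rw [intervalIntegral.integral_sub intervalIntegral.intervalIntegrable_id
            (intervalIntegral.intervalIntegrable_pow 2), integral_id, integral_pow]
          norm_num
  rw [smoothstep, ← intervalIntegral.integral_add_adjacent_intervals (integrable 0 1)
    (integrable 1 t), integral_unit, integral_tail, add_zero]

lemma smoothstep_mem_Icc (t : ℝ) : smoothstep t ∈ Icc (0 : ℝ) 1 := by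
  constructor
  · rw [← smoothstep_of_nonpos (min_le_right t 0)]
    exact monotone_smoothstep (min_le_left t 0)
  · rw [← smoothstep_of_one_le (le_max_right t 1)]
    exact monotone_smoothstep (le_max_left t 1)

/-- An even `C¹` cutoff function, equal to `1` for `x² ≤ 3 / 2` and to `0` for `3 ≤ x²`. -/
def cutoff (x : ℝ) : ℝ := smoothstep (2 - 2 / 3 * x ^ 2)

lemma cutoff_eq_one {x : ℝ} (hx : x ^ 2 ≤ 3 / 2) : cutoff x = 1 :=
  smoothstep_of_one_le (by linarith)

lemma cutoff_eq_zero {x : ℝ} (hx : 3 ≤ x ^ 2) : cutoff x = 0 :=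
  smoothstep_of_nonpos (by linarith)

lemma hasDerivAt_cutoff (x : ℝ) :
    HasDerivAt cutoff
      (6 * max 0 ((2 - 2 / 3 * x ^ 2) * (1 - (2 - 2 / 3 * x ^ 2))) * -(2 / 3 * (2 * x))) x := by
  have inner_deriv : HasDerivAt (fun x : ℝ => 2 - 2 / 3 * x ^ 2) (-(2 / 3 * (2 * x))) x := by
    simpa using ((hasDerivAt_pow 2 x).const_mul (2 / 3 : ℝ)).const_sub 2
  exact (hasDerivAt_smoothstep _).comp x inner_deriv

lemma abs_deriv_cutoff_le {x : ℝ} (hx : |x| ≤ 2) : |deriv cutoff x| ≤ 4 := by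
  have slope_le (t : ℝ) : 6 * max 0 (t * (1 - t)) ≤ 3 / 2 := by
    have := max_le (by norm_num : (0 : ℝ) ≤ 1 / 4)
      (by nlinarith [sq_nonneg (2 * t - 1)] : t * (1 - t) ≤ 1 / 4)
    linarith
  rw [(hasDerivAt_cutoff x).deriv, abs_mul, abs_neg, abs_of_nonneg (by positivity), abs_mul,
    abs_mul, abs_two, abs_of_pos (by norm_num : (0 : ℝ) < 2 / 3)]
  have factor_le : 2 / 3 * (2 * |x|) ≤ 8 / 3 := by linarith
  exact (mul_le_mul (slope_le _) factor_le (by positivity) (by norm_num)).trans_eq (by norm_num)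

lemma norm_deriv_le_of_strip {H : ℂ → ℂ} {δ r s : ℝ} (hH : DifferentiableOn ℂ H {z | |z.re| < s})
    (hδ : ∀ z : ℂ, |z.re| < s → ‖H z‖ ≤ δ) (hr : 0 < r) {z : ℂ} (hz : |z.re| + r < s) :
    ‖deriv H z‖ ≤ δ / r := by
  have ball_subset : Metric.closedBall z r ⊆ {z : ℂ | |z.re| < s} := fun w hw => by
    have re_close : |w.re - z.re| ≤ r :=
      (abs_re_le_norm (w - z)).trans (mem_closedBall_iff_norm.mp hw)
    rw [mem_ofPred_eq]
    linarith [abs_sub_abs_le_abs_sub w.re z.re]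
  exact norm_deriv_le_of_forall_mem_sphere_norm_le hr
    ((hH.mono ball_subset).diffContOnCl_ball subset_rfl)
    fun w hw => hδ w (ball_subset (Metric.sphere_subset_closedBall hw))

/-- The product of `H` with the cutoff function of the real part. -/
def cut (H : ℂ → ℂ) (z : ℂ) : ℂ := cutoff z.re • H z

section Cut

variable {H : ℂ → ℂ} {z : ℂ}

lemma cut_eq_self (hz : z.re ^ 2 ≤ 3 / 2) : cut H z = H z := by
  rw [cut, cutoff_eq_one hz, one_smul]

lemma cut_eq_zero (hz : 3 ≤ z.re ^ 2) : cut H z = 0 := by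
  rw [cut, cutoff_eq_zero hz, zero_smul]

lemma hasFDerivAt_cut_zero (hz : 3 < z.re ^ 2) : HasFDerivAt (cut H) (0 : ℂ →L[ℝ] ℂ) z := by
  have far_open : IsOpen {w : ℂ | 3 < w.re ^ 2} := isOpen_lt continuous_const (by fun_prop)
  refine (hasFDerivAt_const (0 : ℂ) z).congr_of_eventuallyEq ?_
  filter_upwards [far_open.mem_nhds hz] with w hw using cut_eq_zero (le_of_lt hw)

lemma hasFDerivAt_cut (hH : DifferentiableAt ℂ H z) :
    HasFDerivAt (cut H) (cutoff z.re • fderiv ℝ H z +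
      (deriv cutoff z.re • reCLM).smulRight (H z)) z := by
  have cutoff_re : HasFDerivAt (fun w : ℂ => cutoff w.re) (deriv cutoff z.re • reCLM) z :=
    (hasDerivAt_cutoff z.re).differentiableAt.hasDerivAt.comp_hasFDerivAt z reCLM.hasFDerivAt
  exact cutoff_re.smul (hH.restrictScalars ℝ).hasFDerivAt

lemma norm_fderiv_cut_le (hH : DifferentiableAt ℂ H z) (hz : |z.re| ≤ 2) :
    ‖fderiv ℝ (cut H) z‖ ≤ ‖deriv H z‖ + 4 * ‖H z‖ := by
  have cutoff_le : ‖cutoff z.re‖ ≤ 1 := by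
    have mem := smoothstep_mem_Icc (2 - 2 / 3 * z.re ^ 2)
    exact (Real.norm_of_nonneg mem.1).le.trans mem.2
  have fderiv_norm : ‖fderiv ℝ H z‖ = ‖deriv H z‖ := by
    rw [hH.fderiv_restrictScalars ℝ, ContinuousLinearMap.norm_restrictScalars,
      norm_deriv_eq_norm_fderiv]
  rw [(hasFDerivAt_cut hH).fderiv]
  refine (norm_add_le _ _).trans ?_
  rw [norm_smul, ContinuousLinearMap.norm_smulRight_apply, norm_smul, reCLM_norm, mul_one,
    fderiv_norm]
  gcongr
  · exact mul_le_of_le_one_left (norm_nonneg _) cutoff_le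
  · exact abs_deriv_cutoff_le hz

end Cut

/-! ### Perturbations preserving the sides of a half-strip -/

/-- A real-differentiable `k`-Lipschitz displacement field, vanishing for `b ≤ Re z`, that is
tangent to the boundary lines `Re = 0`, `Im = 0` and `Im = 1` of the half-strip
`[0, ∞) × [0, 1]`. -/
structure IsStripPerturbation (k : NNReal) (b : ℝ) (g : ℂ → ℂ) : Prop where
  differentiable : Differentiable ℝ g
  lipschitz : LipschitzWith k g
  im_eq_zero : ∀ z : ℂ, z.im ∈ ({0, 1} : Set ℝ) → (g z).im = 0
  re_eq_zero : ∀ z : ℂ, z.re = 0 → (g z).re = 0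
  eq_zero : ∀ z : ℂ, b ≤ z.re → g z = 0

lemma isStripPerturbation_cut {H : ℂ → ℂ} {δ : NNReal}
    (holo : DifferentiableOn ℂ H {z | |z.re| < 5 / 2})
    (bound : ∀ z : ℂ, |z.re| < 5 / 2 → ‖H z‖ ≤ δ)
    (im_eq_zero : ∀ z : ℂ, z.im ∈ ({0, 1} : Set ℝ) → (H z).im = 0)
    (re_eq_zero : ∀ z : ℂ, z.re = 0 → (H z).re = 0) :
    IsStripPerturbation (6 * δ) 2 (cut H) := by
  have holoAt {z : ℂ} (hz : |z.re| < 2) : DifferentiableAt ℂ H z :=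
    holo.differentiableAt <|
      (isOpen_lt (by fun_prop) continuous_const).mem_nhds (by rw [mem_ofPred_eq]; linarith)
  have far {z : ℂ} (hz : 2 ≤ |z.re|) : HasFDerivAt (cut H) (0 : ℂ →L[ℝ] ℂ) z :=
    hasFDerivAt_cut_zero (by rw [← sq_abs]; nlinarith)
  have differentiable : Differentiable ℝ (cut H) := fun z => by
    rcases lt_or_ge |z.re| 2 with near | hz
    · exact (hasFDerivAt_cut (holoAt near)).differentiableAt
    · exact (far hz).differentiableAt
  refine ⟨differentiable, lipschitzWith_of_nnnorm_fderiv_le differentiable fun z => ?_,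
    fun z hz => by rw [cut, smul_im, im_eq_zero z hz, smul_zero],
    fun z hz => by rw [cut, smul_re, re_eq_zero z hz, smul_zero],
    fun z hz => cut_eq_zero (by nlinarith)⟩
  rcases lt_or_ge |z.re| 2 with near | hz
  · rw [← NNReal.coe_le_coe, coe_nnnorm, NNReal.coe_mul, NNReal.coe_ofNat]
    have fderiv_le := norm_fderiv_cut_le (holoAt near) near.le
    have deriv_le := norm_deriv_le_of_strip (r := 1 / 2) holo bound (by norm_num)
      (by linarith : |z.re| + 1 / 2 < 5 / 2)
    linarith [bound z (by linarith)]
  · simp [(far hz).fderiv]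

lemma le_add_iff_of_abs_le_mul {k s t y : ℝ} (hk : k < 1) (h : |s| ≤ k * |t - y|) :
    y ≤ t + s ↔ y ≤ t := by
  obtain ⟨lower, upper⟩ := abs_le.mp h
  rcases le_or_gt y t with hyt | hty
  · rw [abs_of_nonneg (sub_nonneg.mpr hyt)] at lower
    exact ⟨fun _ => hyt, fun _ => by nlinarith⟩
  · rw [abs_of_neg (sub_neg.mpr hty)] at upper
    exact ⟨fun _ => by nlinarith, fun _ => by linarith⟩

namespace IsStripPerturbation

variable {k : NNReal} {b : ℝ} {g : ℂ → ℂ}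

lemma abs_re_le (hg : IsStripPerturbation k b g) (z : ℂ) : |(g z).re| ≤ k * |z.re| := by
  have displacement := (abs_re_le_norm _).trans (hg.lipschitz.norm_sub_le z (z.im * I))
  rwa [sub_re, hg.re_eq_zero (z.im * I) (by simp), sub_zero,
    show z - z.im * I = (z.re : ℂ) from sub_eq_of_eq_add (re_add_im z).symm, norm_real]
    at displacement

lemma abs_im_le (hg : IsStripPerturbation k b g) (z : ℂ) {y : ℝ} (hy : y ∈ ({0, 1} : Set ℝ)) :
    |(g z).im| ≤ k * |z.im - y| := by
  have displacement := (abs_im_le_norm _).trans (hg.lipschitz.norm_sub_le z (z.re + y * I))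
  have difference : z - (z.re + y * I) = (z.im - y : ℝ) * I := by
    conv_lhs => rw [← re_add_im z]
    simp only [add_re, ofReal_re, mul_re, I_re, mul_zero, ofReal_im, I_im, mul_one, sub_self,
      add_zero, ofReal_sub]
    ring
  rwa [sub_im, hg.im_eq_zero (z.re + y * I) (by simpa using hy), sub_zero, difference, norm_mul,
    norm_I, mul_one, norm_real] at displacement

lemma add_mem_halfStrip_iff (hg : IsStripPerturbation k b g) (hk : k < 1) (z : ℂ) :
    (0 ≤ (z + g z).re ∧ (z + g z).im ∈ Icc (0 : ℝ) 1) ↔ 0 ≤ z.re ∧ z.im ∈ Icc (0 : ℝ) 1 := by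
  have hk' : (k : ℝ) < 1 := hk
  have re_iff : 0 ≤ z.re + (g z).re ↔ 0 ≤ z.re :=
    le_add_iff_of_abs_le_mul hk' (by simpa using hg.abs_re_le z)
  have im_lower_iff : 0 ≤ z.im + (g z).im ↔ 0 ≤ z.im :=
    le_add_iff_of_abs_le_mul hk' (hg.abs_im_le z (by simp))
  have im_upper_iff : z.im + (g z).im ≤ 1 ↔ z.im ≤ 1 := by
    have := le_add_iff_of_abs_le_mul (s := -(g z).im) (t := -z.im) (y := -1) hk' (by
      simpa [abs_sub_comm, neg_add_eq_sub] using hg.abs_im_le z (y := 1) (by simp))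
    rwa [← neg_add, neg_le_neg_iff, neg_le_neg_iff] at this
  rw [add_re, add_im, mem_Icc, mem_Icc, re_iff, im_lower_iff, im_upper_iff]

lemma le_re_add_iff (hg : IsStripPerturbation k b g) (hk : k < 1) (z : ℂ) :
    b ≤ (z + g z).re ↔ b ≤ z.re := by
  refine ⟨fun hz => ?_, fun hz => by rwa [hg.eq_zero z hz, add_zero]⟩
  have fixed : z + g z + g (z + g z) = z + g z := by rw [hg.eq_zero _ hz, add_zero]
  rwa [(idAddHomeomorph hg.lipschitz hk).injective fixed] at hz

lemma preimage_eq_self (hg : IsStripPerturbation k b g) (hk : k < 1) {S : Set ℂ}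
    (hS : ∀ z : ℂ, z.re < b → (z ∈ S ↔ 0 ≤ z.re ∧ z.im ∈ Icc (0 : ℝ) 1)) :
    idAddHomeomorph hg.lipschitz hk ⁻¹' S = S := by
  ext z
  rw [mem_preimage, idAddHomeomorph_apply]
  rcases le_or_gt b z.re with hz | hz
  · rw [hg.eq_zero z hz, add_zero]
  · have hz' : (z + g z).re < b := by rwa [← not_le, hg.le_re_add_iff hk, not_le]
    rw [hS z hz, hS _ hz', hg.add_mem_halfStrip_iff hk]

lemma image_eq_self (hg : IsStripPerturbation k b g) (hk : k < 1) {S : Set ℂ}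
    (hS : ∀ z : ℂ, z.re < b → (z ∈ S ↔ 0 ≤ z.re ∧ z.im ∈ Icc (0 : ℝ) 1)) :
    idAddHomeomorph hg.lipschitz hk '' S = S := by
  nth_rewrite 1 [← hg.preimage_eq_self hk hS]
  exact Homeomorph.image_preimage _ S

lemma wirtingerBar_eq_zero (hg : IsStripPerturbation k b g) {z : ℂ} (hz : b < z.re) :
    wirtingerBar g z = 0 := by
  have vanishing : g =ᶠ[𝓝 z] fun _ => 0 := by
    filter_upwards [(isOpen_lt continuous_const continuous_re).mem_nhds hz] with w hw
      using hg.eq_zero w (le_of_lt hw)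
  simp [wirtingerBar, vanishing.fderiv_eq]

lemma dilatationSupportedIn (hg : IsStripPerturbation k b g) {Ω : Set ℂ} (hΩ : MeasurableSet Ω)
    (hΩs : ∀ z ∈ Ω, 0 ≤ z.re ∧ z.im ∈ Icc (0 : ℝ) 1) :
    DilatationSupportedIn (fun z => z + g z) Ω (rect b) := by
  refine ⟨_, ⟨_, _, isWeakWirtinger_id_add hg.differentiable hg.lipschitz Ω,
    .of_forall fun z => rfl⟩, ?_⟩
  filter_upwards [ae_restrict_mem hΩ] with z hz hzb
  obtain ⟨re_nonneg, im_mem⟩ := hΩs z hz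
  have far : b < z.re := by
    by_contra! near
    exact hzb ⟨⟨re_nonneg, near⟩, im_mem⟩
  rw [wirtingerBar_id_add (hg.differentiable z), hg.wirtingerBar_eq_zero far, zero_div]

end IsStripPerturbation

/-! ### The perturbation attached to a conformal embedding -/

namespace IsConformalEmbedding

variable {R T L b : ℝ} {E : ℂ → ℂ}

lemma isReflectable_rectInv_sub_id (h : IsConformalEmbedding R T E) (hLT : L < T)
    (hL : rect L ⊆ E '' rect R) : IsReflectable L fun w => rectInv R E w - w where
  continuousOn := (h.continuousOn_rectInv.mono hL).sub continuousOn_id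
  holo := (h.differentiableOn_rectInv.mono (h.openRect_subset_image hL)).sub differentiableOn_id
  im_eq_zero w hw him := by rw [sub_im, h.im_rectInv_of_im_mem hLT hL hw him, sub_self]
  re_eq_zero w hw := by rw [sub_re, h.re_rectInv_of_mem_left_side hw, hw.1, sub_zero]

lemma exists_rectInv_eq_add_sinhSeries (h : IsConformalEmbedding R T E) (hL0 : 0 ≤ L)
    (hLT : L < T) (hL : rect L ⊆ E '' rect R) :
    ∃ a : ℕ → ℝ, (∀ n, |a n| ≤ 4 * Real.exp (-(Real.pi * (n + 1) * L))) ∧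
      ∀ w ∈ rect L, w.re < L → rectInv R E w = w + sinhSeries a w := by
  have im_bound : ∀ w ∈ rect L, |(rectInv R E w - w).im| ≤ 1 := fun w hw => by
    have im_mem := (rectInv_mem_rect (hL hw)).2
    rw [sub_im, abs_le]
    constructor <;> linarith [im_mem.1, im_mem.2, hw.2.1, hw.2.2]
  obtain ⟨a, ha, series⟩ :=
    (h.isReflectable_rectInv_sub_id hLT hL).exists_eq_sinhSeries hL0 im_bound
  exact ⟨a, by simpa only [mul_one] using ha, fun w hw hwL =>
    eq_add_of_sub_eq' (series w hw hwL)⟩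

/-- Were `E z` too far to the right, some point of `[0, a] × [0, 1]` would be mapped into the region
where `E` is `δ`-close to the identity but moved by more than `δ`. -/
lemma re_image_le {a δ : ℝ} (h : IsConformalEmbedding R T E) (haR : a ≤ R)
    (close : ∀ z ∈ rect R, (E z).re ≤ b → |(E z).re - z.re| ≤ δ) (hb : 0 ≤ b)
    (hab : a + δ < b) {z : ℂ} (hz : z ∈ rect a) : (E z).re ≤ a + δ := by
  by_contra! far
  have zero_mem : (0 : ℂ) ∈ rect a := ⟨by simpa using hz.1.1.trans hz.1.2, by simp⟩
  have zero_re : (E 0).re = 0 := by rw [h.map_zero, Complex.zero_re]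
  have re_nonneg : 0 ≤ (E z).re := (h.mapsTo (rect_mono haR hz)).1.1
  obtain ⟨w, hw, hwE⟩ : min b (E z).re ∈ (fun w => (E w).re) '' rect a :=
    (convex_rect a).isPreconnected.intermediate_value zero_mem hz
      (continuous_re.comp_continuousOn (h.continuousOn.mono (rect_mono haR)))
      ⟨zero_re.trans_le (le_min hb re_nonneg), min_le_right _ _⟩
  have w_close := (abs_le.mp (close w (rect_mono haR hw) (hwE.trans_le (min_le_left _ _)))).2
  linarith [lt_min hab far, hw.1.2]

lemma mem_image_rect_iff (h : IsConformalEmbedding R T E) (hb : rect b ⊆ E '' rect R) {z : ℂ}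
    (hz : z.re < b) : z ∈ E '' rect R ↔ 0 ≤ z.re ∧ z.im ∈ Icc (0 : ℝ) 1 := by
  refine ⟨?_, fun ⟨re_nonneg, im_mem⟩ => hb ⟨⟨re_nonneg, hz.le⟩, im_mem⟩⟩
  rintro ⟨w, hw, rfl⟩
  exact ⟨(h.mapsTo hw).1.1, (h.mapsTo hw).2⟩

lemma isAdmissibleMap_id_add {k : NNReal} {ε : ℝ} {g : ℂ → ℂ} (h : IsConformalEmbedding R T E)
    (hg : IsStripPerturbation k b g) (hk : k < 1) (hb : rect b ⊆ E '' rect R) (hb1 : 1 ≤ b)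
    (hbT : b ≤ T) (hε : (1 + k) / (1 - k) < 1 + ε) (hE : ∀ z ∈ rect 1, E z + g (E z) = z) :
    IsAdmissibleMap ε R T E fun z => z + g z := by
  have image_closed : idAddHomeomorph hg.lipschitz hk '' (E '' rect R) = E '' rect R :=
    hg.image_eq_self hk fun z hz => h.mem_image_rect_iff hb hz
  have image_open : idAddHomeomorph hg.lipschitz hk '' (E '' openRect R) = E '' openRect R := by
    rw [h.image_openRect_eq_interior, Homeomorph.image_interior, image_closed]
  have fixed_left {v : ℂ} (hre : v.re = 0) (him : v.im ∈ ({0, 1} : Set ℝ)) : v + g v = v :=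
    add_eq_left.mpr (Complex.ext (hg.re_eq_zero v hre) (hg.im_eq_zero v him))
  have fixed_right {v : ℂ} (hre : v.re = T) : v + g v = v :=
    add_eq_left.mpr (hg.eq_zero v (hbT.trans_eq hre.symm))
  refine ⟨h, (rect_mono hb1).trans hb, (idAddHomeomorph hg.lipschitz hk).continuous.continuousOn,
    ?_, ?_, hE, _, hε, isQuasiconformal_id_add hg.differentiable hg.lipschitz hk
      h.isOpen_image_openRect image_open⟩
  · nth_rewrite 2 [← image_closed]
    exact (idAddHomeomorph hg.lipschitz hk).injective.injOn.bijOn_image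
  · rintro v (rfl | rfl | rfl | rfl)
    · exact fixed_left (by simp [h.map_zero]) (by simp [h.map_zero])
    · exact fixed_right h.re_p₁
    · exact fixed_right h.re_p₂
    · exact fixed_left (by simp [h.map_I]) (by simp [h.map_I])

end IsConformalEmbedding

lemma exp_neg_pi_mul_sub_le {L : ℝ} (hL : 4 ≤ L) :
    Real.exp (-(Real.pi * (L - 5 / 2))) ≤ 1 / 50 := by
  have exponent_ge : 4 ≤ Real.pi * (L - 5 / 2) := by nlinarith [Real.pi_gt_three]
  calc Real.exp (-(Real.pi * (L - 5 / 2))) ≤ Real.exp (-4) := by gcongr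
    _ = (Real.exp 1 ^ 4)⁻¹ := by rw [Real.exp_neg, ← Real.exp_nat_mul]; norm_num
    _ ≤ (2.7 ^ 4)⁻¹ := by gcongr; linarith [Real.exp_one_gt_d9]
    _ ≤ 1 / 50 := by norm_num

/-- The unit square lands in `Re ≤ 11 / 10`, where the cutoff is `1` and the perturbation still is
`rectInv R E - id`. -/
lemma IsConformalEmbedding.exists_isStripPerturbation {R T L : ℝ} {E : ℂ → ℂ}
    (h : IsConformalEmbedding R T E) (hL4 : 4 ≤ L) (hLT : L < T) (hL : rect L ⊆ E '' rect R) :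
    ∃ g : ℂ → ℂ,
      IsStripPerturbation (6 * (5 * Real.exp (-(Real.pi * (L - 5 / 2)))).toNNReal) 2 g ∧
      ∀ z ∈ rect 1, E z + g (E z) = z := by
  obtain ⟨a, ha, series⟩ := h.exists_rectInv_eq_add_sinhSeries (by linarith) hLT hL
  have q_le := exp_neg_pi_mul_sub_le hL4
  set q := Real.exp (-(Real.pi * (L - 5 / 2)))
  have q_pos : 0 < q := Real.exp_pos _
  have bound (w : ℂ) (hw : |w.re| < 5 / 2) : ‖sinhSeries a w‖ ≤ 5 * q := by
    refine (norm_sinhSeries_le ha (by linarith) hw.le).trans ?_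
    rw [← div_eq_mul_inv, div_le_iff₀ (by linarith)]
    nlinarith
  have rectInv_series {z : ℂ} (hz : z ∈ rect R) (hEz : (E z).re ≤ 2) :
      E z + sinhSeries a (E z) = z := by
    obtain ⟨re_mem, im_mem⟩ := h.mapsTo hz
    rw [← series (E z) ⟨⟨re_mem.1, by linarith⟩, im_mem⟩ (by linarith), h.rectInv_apply hz]
  have close (z : ℂ) (hz : z ∈ rect R) (hEz : (E z).re ≤ 2) : |(E z).re - z.re| ≤ 1 / 10 := by
    have re_nonneg : 0 ≤ (E z).re := (h.mapsTo hz).1.1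
    have displacement := (abs_re_le_norm _).trans
      (bound (E z) (by rw [abs_of_nonneg re_nonneg]; linarith))
    rw [abs_sub_comm, ← sub_re, ← eq_sub_of_add_eq' (rectInv_series hz hEz)]
    linarith
  refine ⟨cut (sinhSeries a), isStripPerturbation_cut
    (differentiableOn_sinhSeries ha (by linarith))
    (fun w hw => by rw [Real.coe_toNNReal _ (by positivity)]; exact bound w hw)
    (fun w hw => im_sinhSeries_eq_zero hw) (fun w hw => re_sinhSeries_eq_zero hw),
    fun z hz => ?_⟩
  have hzR : z ∈ rect R := rect_mono (by linarith [h.lt]) hz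
  have re_nonneg : 0 ≤ (E z).re := (h.mapsTo hzR).1.1
  have re_le : (E z).re ≤ 1 + 1 / 10 :=
    h.re_image_le (by linarith [h.lt]) close zero_le_two (by norm_num) hz
  rw [cut_eq_self (by nlinarith), rectInv_series hzR (by linarith)]

lemma IsAdmissibleMap.mono {ε ε' R T : ℝ} {E α : ℂ → ℂ} (hα : IsAdmissibleMap ε R T E α)
    (hε : ε ≤ ε') : IsAdmissibleMap ε' R T E α where
  __ := hα
  quasiconformal := hα.quasiconformal.imp fun _ ⟨hK, qc⟩ => ⟨hK.trans_le (by linarith), qc⟩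

lemma DilatationSupportedIn.mono {f : ℂ → ℂ} {Ω A B : Set ℂ} (hf : DilatationSupportedIn f Ω A)
    (hAB : A ⊆ B) : DilatationSupportedIn f Ω B :=
  hf.imp fun _ ⟨dilatation, support⟩ =>
    ⟨dilatation, support.mono fun _ hz hzB => hz fun hzA => hzB (hAB hzA)⟩

lemma exp_neg_pi_mul_two_mul_le {x : ℝ} (hx : 0 < x) :
    Real.exp (-(Real.pi * (2 * x))) ≤ Real.exp (-(Real.pi * (x - 1) / 2)) / x := by
  rw [le_div_iff₀ hx]
  calc Real.exp (-(Real.pi * (2 * x))) * x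
      ≤ Real.exp (-(Real.pi * (2 * x))) * Real.exp x := by
        gcongr
        linarith [Real.add_one_le_exp x]
    _ = Real.exp (-(Real.pi * (2 * x)) + x) := (Real.exp_add _ _).symm
    _ ≤ Real.exp (-(Real.pi * (x - 1) / 2)) := by
        gcongr
        nlinarith [Real.pi_gt_three]

end AdmissibleShapes

end

open AdmissibleShapes

theorem mainTheorem8_general :
    ∃ C : ℝ, 0 < C ∧ ∀ (L T R : ℝ) (E : ℂ → ℂ), 4 ≤ L → L < T → IsConformalEmbedding R T E →
      rect L ⊆ E '' rect R →
      ∃ α : ℂ → ℂ, IsAdmissibleMap (C * Real.exp (-(Real.pi * L))) R T E α ∧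
        DilatationSupportedIn α (E '' openRect R) (rect 2) := by
  refine ⟨180 * Real.exp (Real.pi * (5 / 2)), by positivity, fun L T R E hL4 hLT h hL => ?_⟩
  obtain ⟨g, hg, hgE⟩ := h.exists_isStripPerturbation hL4 hLT hL
  set k : NNReal := 6 * (5 * Real.exp (-(Real.pi * (L - 5 / 2)))).toNNReal with hk
  have k_eq : (k : ℝ) = 30 * Real.exp (-(Real.pi * (L - 5 / 2))) := by
    rw [hk, NNReal.coe_mul, Real.coe_toNNReal _ (by positivity), NNReal.coe_ofNat]
    ring
  have k_pos : (0 : ℝ) < k := by rw [k_eq]; positivity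
  have k_le : (k : ℝ) ≤ 3 / 5 := by linarith [exp_neg_pi_mul_sub_le hL4]
  have K_lt : (1 + (k : ℝ)) / (1 - k) < 1 + 6 * k := by
    rw [div_lt_iff₀ (by linarith)]
    nlinarith
  have ε_eq : 180 * Real.exp (Real.pi * (5 / 2)) * Real.exp (-(Real.pi * L)) = 6 * k := by
    rw [k_eq, mul_assoc, ← Real.exp_add]
    ring_nf
  refine ⟨fun z => z + g z, ?_, hg.dilatationSupportedIn h.isOpen_image_openRect.measurableSet
    fun z hz => ?_⟩
  · rw [ε_eq]
    exact h.isAdmissibleMap_id_add hg (by rw [← NNReal.coe_lt_coe, NNReal.coe_one]; linarith)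
      ((rect_mono (by linarith)).trans hL) one_le_two (by linarith) K_lt hgE
  · have hzT := openRect_subset_rect T (h.image_openRect_subset hz)
    exact ⟨hzT.1.1, hzT.2⟩

theorem mainTheorem8 :
    ∃ C : ℝ, 0 < C ∧ ∀ (T R : ℝ) (M : ℕ) (E : ℂ → ℂ), 6 ≤ T → 2 ≤ M → 2 * (M : ℝ) < T →
      AdmissibleShapes.IsConformalEmbedding R T E →
      AdmissibleShapes.rect (2 * (M : ℝ)) ⊆ E '' AdmissibleShapes.rect R →
      ∃ α : ℂ → ℂ,
        AdmissibleShapes.IsAdmissibleMap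
          (C * (Real.exp (-(Real.pi * ((M : ℝ) - 1) / 2)) / (M : ℝ))) R T E α ∧
        AdmissibleShapes.DilatationSupportedIn α (E '' AdmissibleShapes.openRect R)
          (AdmissibleShapes.rect (M : ℝ)) := by
  obtain ⟨C, C_pos, hC⟩ := mainTheorem8_general
  refine ⟨C, C_pos, fun T R M E _ hM hMT h hL => ?_⟩
  have two_le : (2 : ℝ) ≤ M := by exact_mod_cast hM
  obtain ⟨α, admissible, support⟩ := hC (2 * M) T R E (by linarith) hMT h hL
  exact ⟨α, admissible.mono (mul_le_mul_of_nonneg_left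
    (exp_neg_pi_mul_two_mul_le (by linarith)) C_pos.le), support.mono (rect_mono two_le)⟩
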